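/- **Problem.** An instance of FLaMECaST (Flow-weighted Layered Minimal Euclidean Capacitated Steiner Tree) with $\lambda\ge 0$ intermediate layers consists of a finite set $S$ of sources and a finite set $T$ of sinks, each with a fixed position in $\mathbb{R}^2$ (positions may coincide), integer capacities $c_0\ge c_1\ge\dots\ge c_{\lambda+1}\ge 1$, and a cost parameter $\alpha\in[0,1]$. A *layout* is a finite rooted forest $F$ of height at most $\lambda+1$, with edges directed towards the roots, whose leaves are exactly the sources and all of whose roots are sinks, together with a map $\mathrm{pos}$ from its vertices to $\mathbb{R}^2$ that agrees with the given positions on the sources and sinks; the remaining vertices (Steiner vertices) may be placed anywhere. The layer of a vertex is the length of its path to its root, and the load $\ell(v)$ is the number of leaves in the subtree of $v$. The layout is *valid* if $\ell(v)\le c_i$ for every vertex $v$ in layer $i$, $0\le i\le\lambda+1$. Its cost is $\sum_{uv}\|\mathrm{pos}(u)-\mathrm{pos}(v)\|\cdot\ell(u)^\alpha$, summed over all edges from a child $u$ to its parent $v$. To solve an instance means to output a valid layout of minimum cost among all valid layouts, or to report that there is no valid layout. **Theorem.** There is an algorithm (a single program for a uniform-cost real RAM with exact real arithmetic, including square roots)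 that solves every FLaMECaST instance with $\alpha=1$ or with no intermediate layers ($\lambda=0$) in $O\big((c_0\cdot|T|)^3\big)$ time (read as $O\big((c_0\cdot|T|)^3+1\big)$ so that $T=\emptyset$ is covered), with an absolute constant. -/

import Mathlib

/-! ## Rooted forests -/

/-- The vertex reached from `v` by following `i` parent pointers, if there is one. -/
def ancestor {V : Type} (parent : V → Option V) : ℕ → V → Option V
  | 0, v => some v
  | i + 1, v => (parent v).bind (ancestor parent i)

/-- A finite rooted forest (edges directed towards the roots) with vertices in `V`, given by its
vertex set and its parent pointers: the edges are the pairs `u v` with `parent u = some v`.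
Every vertex has a (necessarily unique) directed path to a vertex without parent. -/
structure RootedForest (V : Type) where
  verts : Finset V
  parent : V → Option V
  parent_mem : ∀ u v, parent u = some v → u ∈ verts ∧ v ∈ verts
  exists_root : ∀ v ∈ verts, ∃ i r, ancestor parent i v = some r ∧ parent r = none

namespace RootedForest

variable {V : Type}

def IsRoot (F : RootedForest V) (v : V) : Prop := v ∈ F.verts ∧ F.parent v = none

/-- A leaf is a vertex of the forest without children. -/
def IsLeaf (F : RootedForest V) (v : V) : Prop := v ∈ F.verts ∧ ∀ u, F.parent u ≠ some v

/-- `v` lies in layer `i`: the path from `v` to its root has length `i`. -/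
def InLayer (F : RootedForest V) (v : V) (i : ℕ) : Prop :=
  ∃ r, ancestor F.parent i v = some r ∧ F.IsRoot r

/-- The load of `v`: the number of leaves in the subtree of `v` (which contains `v` itself). -/
noncomputable def load (F : RootedForest V) (v : V) : ℕ :=
  Set.ncard {u | F.IsLeaf u ∧ ∃ i, ancestor F.parent i u = some v}

/-- The cost of the embedding `pos`: the sum over all edges `u v` of
`dist (pos u) (pos v) * load u ^ α`. -/
noncomputable def cost (F : RootedForest V) (pos : V → EuclideanSpace ℝ (Fin 2)) (α : ℝ) : ℝ :=
  ∑ u ∈ F.verts,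
    match F.parent u with
    | some v => dist (pos u) (pos v) * (F.load u : ℝ) ^ α
    | none => 0

end RootedForest

/-! ## The FLaMECaST problem -/

namespace FLaMECaST

/-- An instance `(S, T, C, α)` with `lam` intermediate layers. Sources and sinks are indexed, so
that several of them may share a position. -/
structure Instance where
  numSources : ℕ
  numSinks : ℕ
  lam : ℕ
  source : Fin numSources → EuclideanSpace ℝ (Fin 2)
  sink : Fin numSinks → EuclideanSpace ℝ (Fin 2)
  cap : Fin (lam + 2) → ℕ
  cap_antitone : Antitone cap
  one_le_cap : ∀ i, 1 ≤ cap i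
  alpha : ℝ
  alpha_mem : alpha ∈ Set.Icc (0 : ℝ) 1

/-- Sources, sinks, and `m` further (Steiner) vertices. -/
abbrev Vertex (I : Instance) (m : ℕ) : Type := Fin I.numSources ⊕ Fin I.numSinks ⊕ Fin m

abbrev Vertex.source {I : Instance} {m : ℕ} (i : Fin I.numSources) : Vertex I m := Sum.inl i
abbrev Vertex.sink {I : Instance} {m : ℕ} (j : Fin I.numSinks) : Vertex I m := Sum.inr (Sum.inl j)
abbrev Vertex.steiner {I : Instance} {m : ℕ} (l : Fin m) : Vertex I m := Sum.inr (Sum.inr l)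

/-- A layout of `I`: an `S`-`T`-forest of height at most `lam + 1`, with an embedding that respects
the given positions of the sources and sinks. The leaves are exactly the sources and every root
is a sink; sinks need not be used. -/
structure Layout (I : Instance) where
  numSteiner : ℕ
  forest : RootedForest (Vertex I numSteiner)
  leaves : ∀ v, forest.IsLeaf v ↔ ∃ i, v = Vertex.source i
  roots : ∀ v, forest.IsRoot v → ∃ j, v = Vertex.sink j
  height : ∀ v ∈ forest.verts, ∀ i, forest.InLayer v i → i ≤ I.lam + 1
  pos : Vertex I numSteiner → EuclideanSpace ℝ (Fin 2)
  pos_source : ∀ i, pos (Vertex.source i) = I.source i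
  pos_sink : ∀ j, pos (Vertex.sink j) = I.sink j

namespace Layout

variable {I : Instance}

/-- Every vertex in layer `i` has load at most `c_i`. -/
def Valid (L : Layout I) : Prop :=
  ∀ v ∈ L.forest.verts, ∀ i : Fin (I.lam + 2), L.forest.InLayer v i → L.forest.load v ≤ I.cap i

noncomputable def cost (L : Layout I) : ℝ := L.forest.cost L.pos I.alpha

/-- A valid layout of minimum cost among all valid layouts. -/
def Optimal (L : Layout I) : Prop := L.Valid ∧ ∀ L' : Layout I, L'.Valid → L.cost ≤ L'.cost

end Layout

def Feasible (I : Instance) : Prop := ∃ L : Layout I, L.Valid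

end FLaMECaST

/-! ## The real RAM

A uniform-cost random access machine with arrays of natural numbers and arrays of exact real
numbers, programmed in a structured language. A program mentions finitely many arrays. Natural
numbers can be added, subtracted (truncated at zero), compared and used as indices. Real numbers
can be added, subtracted, multiplied, divided and compared, and square roots can be taken; there
is no rounding and no conversion from reals to natural numbers. -/

namespace RealRAM

/-- Memory: `nat a i` is cell `i` of the natural number array `a`, `real a i` is cell `i` of the
real array `a`. -/
structure State where
  nat : ℕ → ℕ → ℕ
  real : ℕ → ℕ → ℝ

inductive NExp
  | const (n : ℕ)
  | get (a : ℕ) (i : NExp)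
  | add (e₁ e₂ : NExp)
  | sub (e₁ e₂ : NExp)

inductive RExp
  | const (z : ℤ)
  | get (a : ℕ) (i : NExp)
  | add (e₁ e₂ : RExp)
  | sub (e₁ e₂ : RExp)
  | mul (e₁ e₂ : RExp)
  | div (e₁ e₂ : RExp)
  | sqrt (e : RExp)

inductive BExp
  | nle (e₁ e₂ : NExp)
  | rle (e₁ e₂ : RExp)
  | not (b : BExp)
  | and (b₁ b₂ : BExp)

def NExp.eval (s : State) : NExp → ℕ
  | .const n => n
  | .get a i => s.nat a (i.eval s)
  | .add e₁ e₂ => e₁.eval s + e₂.eval s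
  | .sub e₁ e₂ => e₁.eval s - e₂.eval s

/-- Division by zero and square roots of negative numbers return zero; both cases can be
recognised by a comparison beforehand. -/
noncomputable def RExp.eval (s : State) : RExp → ℝ
  | .const z => z
  | .get a i => s.real a (i.eval s)
  | .add e₁ e₂ => e₁.eval s + e₂.eval s
  | .sub e₁ e₂ => e₁.eval s - e₂.eval s
  | .mul e₁ e₂ => e₁.eval s * e₂.eval s
  | .div e₁ e₂ => e₁.eval s / e₂.eval s
  | .sqrt e => Real.sqrt (e.eval s)

def BExp.Holds (s : State) : BExp → Prop
  | .nle e₁ e₂ => e₁.eval s ≤ e₂.eval s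
  | .rle e₁ e₂ => e₁.eval s ≤ e₂.eval s
  | .not b => ¬ b.Holds s
  | .and b₁ b₂ => b₁.Holds s ∧ b₂.Holds s

/-- The time to evaluate an expression: one step per constant, memory access and operation. -/
def NExp.time : NExp → ℕ
  | .const _ => 1
  | .get _ i => i.time + 1
  | .add e₁ e₂ => e₁.time + e₂.time + 1
  | .sub e₁ e₂ => e₁.time + e₂.time + 1

def RExp.time : RExp → ℕ
  | .const _ => 1
  | .get _ i => i.time + 1
  | .add e₁ e₂ => e₁.time + e₂.time + 1
  | .sub e₁ e₂ => e₁.time + e₂.time + 1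
  | .mul e₁ e₂ => e₁.time + e₂.time + 1
  | .div e₁ e₂ => e₁.time + e₂.time + 1
  | .sqrt e => e.time + 1

def BExp.time : BExp → ℕ
  | .nle e₁ e₂ => e₁.time + e₂.time + 1
  | .rle e₁ e₂ => e₁.time + e₂.time + 1
  | .not b => b.time + 1
  | .and b₁ b₂ => b₁.time + b₂.time + 1

def State.setNat (s : State) (a i x : ℕ) : State :=
  { s with nat := fun b j => if b = a ∧ j = i then x else s.nat b j }

noncomputable def State.setReal (s : State) (a i : ℕ) (x : ℝ) : State :=
  { s with real := fun b j => if b = a ∧ j = i then x else s.real b j }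

inductive Prog
  | skip
  | setNat (a : ℕ) (i e : NExp)
  | setReal (a : ℕ) (i : NExp) (e : RExp)
  | seq (p q : Prog)
  | ite (b : BExp) (p q : Prog)
  | loop (b : BExp) (p : Prog)

/-- `Exec p s s' t`: started in state `s`, the program `p` halts in state `s'` after `t` steps.
Here `loop b p` repeats `p` as long as `b` holds. -/
inductive Exec : Prog → State → State → ℕ → Prop
  | skip (s : State) : Exec .skip s s 1
  | setNat (s : State) (a : ℕ) (i e : NExp) :
      Exec (.setNat a i e) s (s.setNat a (i.eval s) (e.eval s)) (i.time + e.time + 1)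
  | setReal (s : State) (a : ℕ) (i : NExp) (e : RExp) :
      Exec (.setReal a i e) s (s.setReal a (i.eval s) (e.eval s)) (i.time + e.time + 1)
  | seq {p q : Prog} {s₁ s₂ s₃ : State} {t₁ t₂ : ℕ} :
      Exec p s₁ s₂ t₁ → Exec q s₂ s₃ t₂ → Exec (.seq p q) s₁ s₃ (t₁ + t₂)
  | ite_true {b : BExp} {p q : Prog} {s s' : State} {t : ℕ} :
      b.Holds s → Exec p s s' t → Exec (.ite b p q) s s' (b.time + t + 1)
  | ite_false {b : BExp} {p q : Prog} {s s' : State} {t : ℕ} :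
      ¬ b.Holds s → Exec q s s' t → Exec (.ite b p q) s s' (b.time + t + 1)
  | loop_false {b : BExp} {p : Prog} {s : State} :
      ¬ b.Holds s → Exec (.loop b p) s s (b.time + 1)
  | loop_true {b : BExp} {p : Prog} {s₁ s₂ s₃ : State} {t₁ t₂ : ℕ} :
      b.Holds s₁ → Exec p s₁ s₂ t₁ → Exec (.loop b p) s₂ s₃ t₂ →
      Exec (.loop b p) s₁ s₃ (b.time + t₁ + t₂ + 1)

end RealRAM

/-! ## Input and output of a program for FLaMECaST -/

namespace FLaMECaST

open Classical in
/-- The initial memory. Natural number array `0` holds `|S|`, `|T|`, `lam`; array `1` holds the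
capacities. Real array `0` holds `α`; arrays `1`, `2` hold the coordinates of the sources and
arrays `3`, `4` those of the sinks. All other cells are zero. -/
noncomputable def Instance.input (I : Instance) : RealRAM.State where
  nat a i :=
    if a = 0 ∧ i = 0 then I.numSources
    else if a = 0 ∧ i = 1 then I.numSinks
    else if a = 0 ∧ i = 2 then I.lam
    else if h : a = 1 ∧ i < I.lam + 2 then I.cap ⟨i, h.2⟩
    else 0
  real a i :=
    if a = 0 ∧ i = 0 then I.alpha
    else if h : a = 1 ∧ i < I.numSources then I.source ⟨i, h.2⟩ 0
    else if h : a = 2 ∧ i < I.numSources then I.source ⟨i, h.2⟩ 1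
    else if h : a = 3 ∧ i < I.numSinks then I.sink ⟨i, h.2⟩ 0
    else if h : a = 4 ∧ i < I.numSinks then I.sink ⟨i, h.2⟩ 1
    else 0

/-- Vertices are numbered: first the sources, then the sinks, then the Steiner vertices. -/
def Vertex.index {I : Instance} {m : ℕ} : Vertex I m → ℕ
  | Sum.inl i => i
  | Sum.inr (Sum.inl j) => I.numSources + j
  | Sum.inr (Sum.inr l) => I.numSources + I.numSinks + l

open Classical in
/-- The memory `s` describes the layout `L`: cell `1` of the natural number array `2` holds the
number of Steiner vertices; cell `index v` of array `3` holds `0` if `v` is not a vertex of the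
forest, `1` if `v` is a root, and `index u + 2` if `u` is the parent of `v`; the real arrays
`5`, `6` hold the coordinates of the Steiner vertices. -/
def Layout.EncodedBy {I : Instance} (L : Layout I) (s : RealRAM.State) : Prop :=
  s.nat 2 1 = L.numSteiner ∧
  (∀ v, s.nat 3 (Vertex.index v) =
    if v ∈ L.forest.verts then
      match L.forest.parent v with
      | none => 1
      | some u => Vertex.index u + 2
    else 0) ∧
  ∀ l : Fin L.numSteiner,
    s.real 5 l = L.pos (Vertex.steiner l) 0 ∧ s.real 6 l = L.pos (Vertex.steiner l) 1

/-- The memory `s` holds a correct answer for `I`: cell `0` of the natural number array `2` is `0`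
and `I` has no valid layout, or it is `1` and an optimal valid layout is written to memory. -/
def Instance.SolvedBy (I : Instance) (s : RealRAM.State) : Prop :=
  (s.nat 2 0 = 0 ∧ ¬ Feasible I) ∨
  (s.nat 2 0 = 1 ∧ ∃ L : Layout I, L.Optimal ∧ L.EncodedBy s)

/-- The program `p` solves every instance of the class `A` in `O(f)` steps. -/
def SolvesInTime (p : RealRAM.Prog) (A : Set Instance) (f : Instance → ℕ) : Prop :=
  ∃ K : ℕ, ∀ I ∈ A, ∃ (s : RealRAM.State) (t : ℕ),
    RealRAM.Exec p I.input s t ∧ I.SolvedBy s ∧ t ≤ K * (f I + 1)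

end FLaMECaST

/-!
If `α = 1`, the cost of a layout is the total length of the paths from the sources to their roots, and
without intermediate layers these paths are single edges. In both cases the triangle inequality shows
that no valid layout is cheaper than the sum of the distances of the sources to their roots
(`FLaMECaST.Layout.sum_dist_le_cost`). The root of a source is a sink, and a sink is the root of at
most `c₀` sources. Conversely every assignment of the sources to the sinks with at most `c₀` sources per
sink yields a valid layout, in which every source is a child of its sink, and its cost is that sum
(`FLaMECaST.starLayout`). So the problem is to find a cheapest such assignment
(`FLaMECaST.starLayout_optimal`), and it is feasible if and only if `|S| ≤ c₀ |T|`.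

Replace every sink by `c₀` slots at its position. What remains is a minimum cost matching of the
`n = |S|` sources, the rows, into the `N = c₀ |T|` slots, the columns. It is found by successive
shortest augmenting paths. The algorithm keeps a matching of the first `i` rows together with prices
of the columns, which are nonpositive and vanish on free columns, such that every matched row is in a
column of least reduced cost (`Hungarian.Matching`). These prices certify optimality
(`Hungarian.Matching.sum_le`). For the next row, Dijkstra's algorithm runs on the columns until it
reaches a free one (`Hungarian.Search`); the length of a step is nonnegative because rows are in
cheapest columns. Then the prices of the visited columns are lowered so that every column on the path
found is cheapest for the row before it (`Hungarian.Search.finish`), and the rows are shifted along the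
path (`Hungarian.Augment`).

A phase visits at most `N` columns and spends `O(N)` steps on each of them, and there are `n ≤ N`
phases, which gives `O(N³)` steps. The execution on the real RAM is analysed with Hoare-style rules
for total correctness that also bound the number of steps (`RealRAM.Runs`).
-/

namespace RealRAM

/-! ### Total correctness with time bounds on the real RAM -/

/-- Started in `s`, the program `p` halts within `T` steps in a state that satisfies `Q`. -/
def Runs (p : Prog) (s : State) (T : ℕ) (Q : State → Prop) : Prop :=
  ∃ s' t, Exec p s s' t ∧ t ≤ T ∧ Q s'

theorem Runs.mono {p : Prog} {s : State} {T T' : ℕ} {Q Q' : State → Prop}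
    (h : Runs p s T Q) (hT : T ≤ T') (hQ : ∀ s', Q s' → Q' s') : Runs p s T' Q' := by
  obtain ⟨s', t, he, ht, hq⟩ := h
  exact ⟨s', t, he, ht.trans hT, hQ _ hq⟩

theorem Runs.skip {s : State} {T : ℕ} {Q : State → Prop} (hT : 1 ≤ T) (h : Q s) :
    Runs .skip s T Q :=
  ⟨s, 1, .skip s, hT, h⟩

theorem Runs.setNat {s : State} {a : ℕ} {i e : NExp} {T : ℕ} {Q : State → Prop}
    (hT : i.time + e.time + 1 ≤ T) (h : Q (s.setNat a (i.eval s) (e.eval s))) :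
    Runs (.setNat a i e) s T Q :=
  ⟨_, _, .setNat s a i e, hT, h⟩

theorem Runs.setReal {s : State} {a : ℕ} {i : NExp} {e : RExp} {T : ℕ} {Q : State → Prop}
    (hT : i.time + e.time + 1 ≤ T) (h : Q (s.setReal a (i.eval s) (e.eval s))) :
    Runs (.setReal a i e) s T Q :=
  ⟨_, _, .setReal s a i e, hT, h⟩

theorem Runs.seq {p q : Prog} {s : State} {T₁ T₂ T : ℕ} {P Q : State → Prop}
    (hp : Runs p s T₁ P) (hq : ∀ s', P s' → Runs q s' T₂ Q) (hT : T₁ + T₂ ≤ T) :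
    Runs (.seq p q) s T Q := by
  obtain ⟨s₁, t₁, he₁, ht₁, h₁⟩ := hp
  obtain ⟨s₂, t₂, he₂, ht₂, h₂⟩ := hq _ h₁
  exact ⟨s₂, t₁ + t₂, .seq he₁ he₂, by omega, h₂⟩

theorem Runs.seq_setNat {s : State} {a : ℕ} {i e : NExp} {q : Prog} {T T₂ : ℕ} {Q : State → Prop}
    (h : Runs q (s.setNat a (i.eval s) (e.eval s)) T₂ Q) (hT : i.time + e.time + 1 + T₂ ≤ T) :
    Runs (.seq (.setNat a i e) q) s T Q :=
  Runs.seq (P := fun s' => s' = s.setNat a (i.eval s) (e.eval s)) (Runs.setNat le_rfl rfl)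
    (by rintro _ rfl; exact h) hT

theorem Runs.seq_setReal {s : State} {a : ℕ} {i : NExp} {e : RExp} {q : Prog} {T T₂ : ℕ}
    {Q : State → Prop} (h : Runs q (s.setReal a (i.eval s) (e.eval s)) T₂ Q)
    (hT : i.time + e.time + 1 + T₂ ≤ T) : Runs (.seq (.setReal a i e) q) s T Q :=
  Runs.seq (P := fun s' => s' = s.setReal a (i.eval s) (e.eval s)) (Runs.setReal le_rfl rfl)
    (by rintro _ rfl; exact h) hT

theorem Runs.ite {b : BExp} {p q : Prog} {s : State} {T T' : ℕ} {Q : State → Prop}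
    (hp : b.Holds s → Runs p s T Q) (hq : ¬ b.Holds s → Runs q s T Q)
    (hT : b.time + T + 1 ≤ T') : Runs (.ite b p q) s T' Q := by
  by_cases hb : b.Holds s
  · obtain ⟨s₁, t₁, he, ht, h⟩ := hp hb
    exact ⟨s₁, _, .ite_true hb he, by omega, h⟩
  · obtain ⟨s₁, t₁, he, ht, h⟩ := hq hb
    exact ⟨s₁, _, .ite_false hb he, by omega, h⟩

/-- The rule for loops: `I k` holds after `k` rounds, and the guard can only hold when
`k < n`, so there are at most `n` rounds. -/
theorem Runs.loop {b : BExp} {p : Prog} {s : State} {n T T' : ℕ} {I : ℕ → State → Prop}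
    {Q : State → Prop} (h0 : I 0 s)
    (hstep : ∀ k s, I k s → b.Holds s → k < n ∧ Runs p s T (I (k + 1)))
    (hQ : ∀ k s, I k s → ¬ b.Holds s → Q s)
    (hT : n * (b.time + T + 1) + (b.time + 1) ≤ T') :
    Runs (.loop b p) s T' Q := by
  have key : ∀ m k s, n ≤ k + m → I k s →
      Runs (.loop b p) s (m * (b.time + T + 1) + (b.time + 1)) Q := by
    intro m
    induction m with
    | zero =>
      intro k s hk hI
      by_cases hb : b.Holds s
      · have := (hstep k s hI hb).1
        omega
      · exact ⟨s, _, .loop_false hb, by omega, hQ k s hI hb⟩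
    | succ m ih =>
      intro k s hk hI
      by_cases hb : b.Holds s
      · obtain ⟨s₁, t₁, he₁, ht₁, h₁⟩ := (hstep k s hI hb).2
        obtain ⟨s₂, t₂, he₂, ht₂, h₂⟩ := ih (k + 1) s₁ (by omega) h₁
        refine ⟨s₂, _, .loop_true hb he₁ he₂, ?_, h₂⟩
        rw [Nat.succ_mul]
        omega
      · exact ⟨s, _, .loop_false hb, by omega, hQ k s hI hb⟩
  exact (key n 0 s (by omega) h0).mono hT fun _ h => h

/-- `x` as a variable: cell `0` of the natural number array `x`. -/
abbrev NExp.var (x : ℕ) : NExp := .get x (.const 0)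

/-- `for x = 0, …, bound - 1 do body`, with the counter in the variable `x`. -/
def forN (x : ℕ) (bound : NExp) (body : Prog) : Prog :=
  .seq (.setNat x (.const 0) (.const 0))
    (.loop (.nle (.add (.var x) (.const 1)) bound)
      (.seq body (.setNat x (.const 0) (.add (.var x) (.const 1)))))

/-- The rule for `forN`: `I k` holds when the counter has just become `k`. The bound of the loop may
not change. -/
theorem Runs.forN {x : ℕ} {bound : NExp} {body : Prog} {s : State} {N T T' : ℕ}
    {I : ℕ → State → Prop} {Q : State → Prop} (h0 : I 0 (s.setNat x 0 0))
    (hx : ∀ k s, I k s → s.nat x 0 = k) (hb : ∀ k s, I k s → bound.eval s = N)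
    (hstep : ∀ k s, k < N → I k s →
      Runs body s T fun s' => s'.nat x 0 = k ∧ I (k + 1) (s'.setNat x 0 (k + 1)))
    (hQ : ∀ s, I N s → Q s)
    (hT : N * (T + bound.time + 15) + (bound.time + 15) ≤ T') :
    Runs (RealRAM.forN x bound body) s T' Q := by
  refine Runs.seq (T₁ := 3) (T₂ := N * (T + bound.time + 15) + (bound.time + 12))
    (P := fun s' => s' = s.setNat x 0 0)
    (Runs.setNat (by simp [NExp.time]) (by simp [NExp.eval])) ?_ (by omega)
  rintro _ rfl
  refine Runs.loop (n := N) (T := T + 6) (I := fun k s => k ≤ N ∧ I k s) ⟨Nat.zero_le _, h0⟩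
    ?_ ?_ ?_
  · rintro k s ⟨-, hI⟩ hg
    simp only [BExp.Holds, NExp.eval, hx k s hI, hb k s hI] at hg
    refine ⟨hg, Runs.seq (hstep k s hg hI) (T₂ := 6) ?_ le_rfl⟩
    rintro s' ⟨hk, hI'⟩
    exact Runs.setNat (by simp [NExp.time]) ⟨hg, by simpa [NExp.eval, hk] using hI'⟩
  · rintro k s ⟨hk, hI⟩ hg
    simp only [BExp.Holds, NExp.eval, hx k s hI, hb k s hI] at hg
    obtain rfl : k = N := by omega
    exact hQ s hI
  · simp only [BExp.time, NExp.time]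
    have : N * (1 + 1 + 1 + 1 + bound.time + 1 + (T + 6) + 1)
        ≤ N * (T + bound.time + 15) := Nat.mul_le_mul_left _ (by omega)
    omega

@[simp] theorem State.setNat_real (s : State) (a i x : ℕ) : (s.setNat a i x).real = s.real := rfl

@[simp] theorem State.setReal_nat (s : State) (a i : ℕ) (x : ℝ) :
    (s.setReal a i x).nat = s.nat := rfl

@[simp] theorem State.setNat_nat_self (s : State) (a i x : ℕ) :
    (s.setNat a i x).nat a = Function.update (s.nat a) i x := by
  funext j
  simp [State.setNat, Function.update_apply]

@[simp] theorem State.setReal_real_self (s : State) (a i : ℕ) (x : ℝ) :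
    (s.setReal a i x).real a = Function.update (s.real a) i x := by
  funext j
  simp [State.setReal, Function.update_apply]

@[simp] theorem State.setNat_nat_of_ne (s : State) {a b : ℕ} (i x : ℕ) (h : b ≠ a) :
    (s.setNat a i x).nat b = s.nat b := by
  funext j
  simp [State.setNat, h]

@[simp] theorem State.setReal_real_of_ne (s : State) {a b : ℕ} (i : ℕ) (x : ℝ) (h : b ≠ a) :
    (s.setReal a i x).real b = s.real b := by
  funext j
  simp [State.setReal, h]

/-- `s'` arises from `s` by changes to the natural number arrays in `A` and the real arrays in
`B` only. -/
structure Frame (A B : List ℕ) (s s' : State) : Prop where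
  nat : ∀ a, a ∉ A → s'.nat a = s.nat a
  real : ∀ b, b ∉ B → s'.real b = s.real b

theorem Frame.refl (A B : List ℕ) (s : State) : Frame A B s s :=
  ⟨fun _ _ => rfl, fun _ _ => rfl⟩

theorem Frame.trans {A A' B B' : List ℕ} {s₁ s₂ s₃ : State} (h : Frame A B s₁ s₂)
    (h' : Frame A' B' s₂ s₃) : Frame (A ++ A') (B ++ B') s₁ s₃ := by
  refine ⟨fun a ha => ?_, fun b hb => ?_⟩
  · rw [List.mem_append, not_or] at ha
    rw [h'.nat a ha.2, h.nat a ha.1]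
  · rw [List.mem_append, not_or] at hb
    rw [h'.real b hb.2, h.real b hb.1]

theorem Frame.mono {A A' B B' : List ℕ} {s s' : State} (h : Frame A B s s') (hA : A ⊆ A')
    (hB : B ⊆ B') : Frame A' B' s s' :=
  ⟨fun a ha => h.nat a fun h => ha (hA h), fun b hb => h.real b fun h => hb (hB h)⟩

theorem Frame.setNat {A B : List ℕ} {s s' : State} (h : Frame A B s s') {a : ℕ} (i x : ℕ)
    (ha : a ∈ A) : Frame A B s (s'.setNat a i x) := by
  refine ⟨fun b hb => ?_, h.real⟩
  rw [State.setNat_nat_of_ne _ _ _ (by rintro rfl; exact hb ha), h.nat b hb]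

theorem Frame.setReal {A B : List ℕ} {s s' : State} (h : Frame A B s s') {b : ℕ} (i : ℕ) (x : ℝ)
    (hb : b ∈ B) : Frame A B s (s'.setReal b i x) := by
  refine ⟨h.nat, fun c hc => ?_⟩
  rw [State.setReal_real_of_ne _ _ _ (by rintro rfl; exact hc hb), h.real c hc]

end RealRAM

namespace Hungarian

/-! ### Minimum cost assignments by shortest augmenting paths -/

/-- The rows `1, …, i` are matched to the columns `0, …, N - 1`: column `t` has the row `p t`, or
no row if `p t = 0`. Row `r` has cost `c r t` in column `t`. The prices `v` certify that the cost
is minimal: every row is in a column that is cheapest for it at these prices. -/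
structure Matching (N : ℕ) (c : ℕ → ℕ → ℝ) (i : ℕ) (p : ℕ → ℕ) (v : ℕ → ℝ) : Prop where
  le : ∀ t < N, p t ≤ i
  inj : ∀ t < N, ∀ t' < N, p t = p t' → p t ≠ 0 → t = t'
  surj : ∀ r, 1 ≤ r → r ≤ i → ∃ t < N, p t = r
  price_nonpos : ∀ t < N, v t ≤ 0
  price_free : ∀ t < N, p t = 0 → v t = 0
  cheapest : ∀ t < N, p t ≠ 0 → ∀ t' < N, c (p t) t - v t ≤ c (p t) t' - v t'

/-- The state of Dijkstra's algorithm from the new row `r`: `dist t` is the length of a path to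
column `t` through the `k` columns visited so far, `way t` the column before `t` on that path, or
`N` if the path goes directly from `r` to `t`, and `used t` the time at which `t` was visited, or
`0` if it was not. The length of a step from a row to a column is the reduced cost there
minus the reduced cost in its present column. -/
structure Search (N : ℕ) (c : ℕ → ℕ → ℝ) (r : ℕ) (p : ℕ → ℕ) (v : ℕ → ℝ) (k : ℕ)
    (dist : ℕ → ℝ) (way used : ℕ → ℕ) : Prop where
  used_le : ∀ t < N, used t ≤ k
  card_used : ((Finset.range N).filter fun t => used t ≠ 0).card = k
  matched : ∀ t < N, used t ≠ 0 → p t ≠ 0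
  le_direct : ∀ t < N, dist t ≤ c r t - v t
  le_step : ∀ w < N, used w ≠ 0 → ∀ t < N,
    dist t ≤ dist w + (c (p w) t - v t) - (c (p w) w - v w)
  mono : ∀ w < N, used w ≠ 0 → ∀ t < N, used t = 0 → dist w ≤ dist t
  way : ∀ t < N, (way t = N ∧ dist t = c r t - v t) ∨
    (way t < N ∧ used (way t) ≠ 0 ∧ (used t = 0 ∨ used (way t) < used t) ∧
      dist t = dist (way t) + (c (p (way t)) t - v t) - (c (p (way t)) (way t) - v (way t)))

/-- Column `j` is an unvisited column of least distance. -/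
def Nearest (N : ℕ) (dist : ℕ → ℝ) (used : ℕ → ℕ) (j : ℕ) : Prop :=
  j < N ∧ used j = 0 ∧ ∀ t < N, used t = 0 → dist j ≤ dist t

/-- At column `t`, the distances `dist'` and the pointers `way'` arise from `dist` and `way` by
admitting the paths of length `cand` through column `j`. -/
def RelaxedAt (used : ℕ → ℕ) (j : ℕ) (cand dist dist' : ℕ → ℝ) (way way' : ℕ → ℕ) (t : ℕ) :
    Prop :=
  (used t = 0 ∧ cand t < dist t) ∧ dist' t = cand t ∧ way' t = j ∨
    ¬(used t = 0 ∧ cand t < dist t) ∧ dist' t = dist t ∧ way' t = way t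

variable {N : ℕ} {c : ℕ → ℕ → ℝ}

/-- While fewer rows than columns are matched, the search can always go on. -/
theorem Matching.exists_free {i : ℕ} {p : ℕ → ℕ} {v : ℕ → ℝ} (h : Matching N c i p v)
    (hi : i < N) : ∃ t < N, p t = 0 := by
  by_contra! hne
  have : (Finset.range N).card ≤ (Finset.Icc 1 i).card := by
    refine Finset.card_le_card_of_injOn p (fun t ht => ?_) fun t ht t' ht' he => ?_
    · have ht := Finset.mem_range.1 ht
      simp only [Finset.coe_Icc, Set.mem_Icc]
      exact ⟨Nat.one_le_iff_ne_zero.2 (hne t ht), h.le t ht⟩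
    · have ht := Finset.mem_range.1 ht
      exact h.inj t ht t' (Finset.mem_range.1 ht') he (hne t ht)
  simp at this
  omega

theorem Search.exists_unused {i r k : ℕ} {p : ℕ → ℕ} {v dist : ℕ → ℝ} {way used : ℕ → ℕ}
    (hm : Matching N c i p v) (hi : i < N) (h : Search N c r p v k dist way used) :
    ∃ t < N, used t = 0 := by
  obtain ⟨t, ht, hp⟩ := hm.exists_free hi
  exact ⟨t, ht, by by_contra hu; exact h.matched t ht hu hp⟩

theorem Search.init {r : ℕ} {p : ℕ → ℕ} {v dist : ℕ → ℝ} {way used : ℕ → ℕ}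
    (hd : ∀ t < N, dist t = c r t - v t) (hw : ∀ t < N, way t = N) (hu : ∀ t < N, used t = 0) :
    Search N c r p v 0 dist way used where
  used_le t ht := (hu t ht).le
  card_used := by
    rw [Finset.card_eq_zero, Finset.filter_eq_empty_iff]
    intro t ht
    simpa using hu t (Finset.mem_range.1 ht)
  matched t ht h := absurd (hu t ht) h
  le_direct t ht := (hd t ht).le
  le_step w hw h := absurd (hu w hw) h
  mono w hw h := absurd (hu w hw) h
  way t ht := Or.inl ⟨hw t ht, hd t ht⟩

/-- Visiting a column increases the number of visited columns, so there are at most `N` visits. -/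
theorem card_used_update {used : ℕ → ℕ} {j k m : ℕ} (hj : j < N) (hu : used j = 0) (hm : m ≠ 0)
    (h : ((Finset.range N).filter fun t => used t ≠ 0).card = k) :
    ((Finset.range N).filter fun t => Function.update used j m t ≠ 0).card = k + 1 := by
  have : ((Finset.range N).filter fun t => Function.update used j m t ≠ 0)
      = insert j ((Finset.range N).filter fun t => used t ≠ 0) := by
    ext t
    by_cases htj : t = j
    · subst htj; simp [hj, hm]
    · simp [htj]
  rw [this, Finset.card_insert_of_notMem (by simp [hu]), h]

theorem Search.lt {r k j : ℕ} {p : ℕ → ℕ} {v dist : ℕ → ℝ} {way used : ℕ → ℕ}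
    (h : Search N c r p v k dist way used) (hj : j < N) (hu : used j = 0) : k < N := by
  have := card_used_update hj hu one_ne_zero h.card_used
  have := Finset.card_filter_le (Finset.range N) fun t => Function.update used j 1 t ≠ 0
  simp only [Finset.card_range] at this
  omega

/-- Visiting the nearest column `j` and relaxing the distances along its row. -/
theorem Search.step {i r k j : ℕ} {p : ℕ → ℕ} {v dist dist' : ℕ → ℝ} {way way' used : ℕ → ℕ}
    (hm : Matching N c i p v) (h : Search N c r p v k dist way used)
    (hj : Nearest N dist used j) (hp : p j ≠ 0)
    {cand : ℕ → ℝ}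
    (hcand : ∀ t, cand t = dist j + (c (p j) t - v t) - (c (p j) j - v j))
    (hrelax : ∀ t < N, RelaxedAt (Function.update used j (k + 1)) j cand dist dist' way way' t) :
    Search N c r p v (k + 1) dist' way' (Function.update used j (k + 1)) := by
  obtain rfl : cand = fun t => dist j + (c (p j) t - v t) - (c (p j) j - v j) := funext hcand
  simp only [RelaxedAt] at hrelax
  obtain ⟨hjN, hju, hmin⟩ := hj
  have hne : ∀ t, Function.update used j (k + 1) t ≠ 0 → t ≠ j → used t ≠ 0 := by
    intro t ht htj
    rwa [Function.update_of_ne htj] at ht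
  have hdle : ∀ t < N, dist' t ≤ dist t := by
    intro t ht
    rcases hrelax t ht with ⟨⟨-, h1⟩, h2, -⟩ | ⟨-, h2, -⟩
    · exact h2 ▸ h1.le
    · exact h2.le
  -- the distances of visited columns are final
  have hdeq : ∀ t < N, Function.update used j (k + 1) t ≠ 0 → dist' t = dist t := by
    intro t ht hu
    rcases hrelax t ht with ⟨⟨h0, -⟩, -⟩ | ⟨-, h2, -⟩
    · exact absurd h0 hu
    · exact h2
  have hweq : ∀ t < N, Function.update used j (k + 1) t ≠ 0 → way' t = way t := by
    intro t ht hu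
    rcases hrelax t ht with ⟨⟨h0, -⟩, -⟩ | ⟨-, -, h2⟩
    · exact absurd h0 hu
    · exact h2
  have hself : Function.update used j (k + 1) j = k + 1 := Function.update_self ..
  have hold : ∀ t, used t ≠ 0 → Function.update used j (k + 1) t = used t := by
    intro t ht
    exact Function.update_of_ne (by rintro rfl; exact ht hju) _ _
  refine ⟨fun t ht => ?_, card_used_update hjN hju (by omega) h.card_used, fun t ht hu => ?_,
    fun t ht => (hdle t ht).trans (h.le_direct t ht), fun w hw hu t ht => ?_,
    fun w hw hu t ht hut => ?_, fun t ht => ?_⟩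
  · by_cases htj : t = j
    · rw [htj, hself]
    · rw [Function.update_of_ne htj]
      exact (h.used_le t ht).trans (Nat.le_succ _)
  · by_cases htj : t = j
    · rwa [htj]
    · exact h.matched t ht (hne t hu htj)
  · rw [hdeq w hw hu]
    by_cases hwj : w = j
    · subst hwj
      rcases hrelax t ht with ⟨-, h2, -⟩ | ⟨h1, h2, -⟩
      · exact h2.le
      · by_cases hut : Function.update used w (k + 1) t = 0
        · rw [h2]
          by_contra hlt
          exact h1 ⟨hut, not_le.1 hlt⟩
        · rw [h2]
          have hc := hm.cheapest w hw hp t ht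
          have : dist t ≤ dist w := by
            by_cases htw : t = w
            · rw [htw]
            · exact h.mono t ht (hne t hut htw) w hw hju
          linarith
    · exact (hdle t ht).trans (h.le_step w hw (hne w hu hwj) t ht)
  · have htj : t ≠ j := by
      rintro rfl
      omega
    have hut' : used t = 0 := by rwa [Function.update_of_ne htj] at hut
    have hwj : dist w ≤ dist j := by
      by_cases hwj : w = j
      · rw [hwj]
      · exact h.mono w hw (hne w hu hwj) j hjN hju
    rw [hdeq w hw hu]
    rcases hrelax t ht with ⟨-, h2, -⟩ | ⟨-, h2, -⟩
    · have := hm.cheapest j hjN hp t ht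
      linarith
    · rw [h2]
      exact hwj.trans (hmin t ht hut')
  · rcases hrelax t ht with ⟨⟨h0, -⟩, h2, h3⟩ | ⟨-, h2, h3⟩
    · right
      rw [h3]
      refine ⟨hjN, by omega, Or.inl h0, ?_⟩
      rw [h2, hdeq j hjN (by omega)]
    · rw [h2, h3]
      rcases h.way t ht with h4 | ⟨h5, h6, h7, h8⟩
      · exact Or.inl h4
      · right
        have hw' := hold _ h6
        refine ⟨h5, by rwa [hw'], ?_, ?_⟩
        · rw [hw']
          by_cases htj : t = j
          · right
            have := h.used_le _ h5
            rw [htj, hself]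
            rw [htj] at this
            omega
          · rw [Function.update_of_ne htj]
            exact h7
        · rw [hdeq _ h5 (by rwa [hw'])]
          exact h8

/-- The state of the augmentation along the `way` pointers. The column `j` (or the auxiliary
column `N`) is the hole: its entry in `q` is outdated and has to be replaced by the row of column
`way j`. All other rows are in cheapest columns, and the part of the path that is still ahead
carries its original rows `p`. -/
structure Augment (N : ℕ) (c : ℕ → ℕ → ℝ) (i : ℕ) (p : ℕ → ℕ) (v : ℕ → ℝ) (used : ℕ → ℕ)
    (q : ℕ → ℕ) (j : ℕ) : Prop where
  hole : j = N ∨ j < N ∧ used j ≠ 0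
  le : ∀ t ≤ N, q t ≤ i
  inj : ∀ t ≤ N, ∀ t' ≤ N, t ≠ j → t' ≠ j → q t = q t' → q t ≠ 0 → t = t'
  surj : ∀ r, 1 ≤ r → r ≤ i → ∃ t ≤ N, t ≠ j ∧ q t = r
  price_free : ∀ t < N, t ≠ j → q t = 0 → v t = 0
  cheapest : ∀ t < N, t ≠ j → q t ≠ 0 → ∀ t' < N, c (q t) t - v t ≤ c (q t) t' - v t'
  ahead : ∀ t, (j ≠ N ∧ t = N) ∨ (t < N ∧ used t ≠ 0 ∧ used t < used j ∧ j ≠ N) → q t = p t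

/-- What the search provides for the augmentation at the new prices `v`: every visited column
is a cheapest column for the row of the column before it. -/
structure Path (N : ℕ) (c : ℕ → ℕ → ℝ) (p : ℕ → ℕ) (v : ℕ → ℝ) (way used : ℕ → ℕ) : Prop where
  back : ∀ t < N, used t ≠ 0 →
    way t = N ∨ way t < N ∧ used (way t) ≠ 0 ∧ used (way t) < used t
  row_ne_zero : ∀ t < N, used t ≠ 0 → p (way t) ≠ 0
  cheapest : ∀ t < N, used t ≠ 0 →
    ∀ t' < N, c (p (way t)) t - v t ≤ c (p (way t)) t' - v t'

/-- The row of column `way j` moves to column `j`, and column `way j` becomes the hole. -/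
theorem Augment.step {i j : ℕ} {p q : ℕ → ℕ} {v : ℕ → ℝ} {way used : ℕ → ℕ}
    (h : Augment N c i p v used q j) (hw : Path N c p v way used) (hj : j ≠ N) :
    Augment N c i p v used (Function.update q j (q (way j))) (way j) := by
  obtain ⟨hjN, hju⟩ : j < N ∧ used j ≠ 0 := h.hole.resolve_left hj
  have hway := hw.back j hjN hju
  have hwle : way j ≤ N := by omega
  have hne : way j ≠ j := by
    rintro he
    rw [he] at hway
    omega
  have hq : q (way j) = p (way j) := by
    refine h.ahead _ ?_
    rcases hway with h1 | ⟨h1, h2, h3⟩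
    · exact Or.inl ⟨hj, h1⟩
    · exact Or.inr ⟨h1, h2, h3, hj⟩
  refine ⟨?_, fun t ht => ?_, fun t ht t' ht' htw htw' he h0 => ?_, fun r hr hri => ?_,
    fun t ht htw h0 => ?_, fun t ht htw h0 t' ht' => ?_, fun t ht => ?_⟩
  · rcases hway with h1 | ⟨h1, h2, -⟩
    · exact Or.inl h1
    · exact Or.inr ⟨h1, h2⟩
  · rw [Function.update_apply]
    split_ifs
    · exact h.le _ hwle
    · exact h.le t ht
  · by_cases htj : t = j <;> by_cases htj' : t' = j
    · rw [htj, htj']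
    · subst htj
      rw [Function.update_self] at he h0
      rw [Function.update_of_ne htj'] at he
      exact absurd (h.inj _ hwle t' ht' hne htj' he h0).symm htw'
    · subst htj'
      rw [Function.update_self, Function.update_of_ne htj] at he
      rw [Function.update_of_ne htj] at h0
      exact absurd (h.inj t ht _ hwle htj hne he h0) htw
    · rw [Function.update_of_ne htj] at he h0
      rw [Function.update_of_ne htj'] at he
      exact h.inj t ht t' ht' htj htj' he h0
  · obtain ⟨t, ht, htj, hqt⟩ := h.surj r hr hri
    by_cases htw : t = way j
    · exact ⟨j, hjN.le, hne.symm, by rw [Function.update_self, ← htw, hqt]⟩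
    · exact ⟨t, ht, htw, by rw [Function.update_of_ne htj, hqt]⟩
  · by_cases htj : t = j
    · subst htj
      rw [Function.update_self] at h0
      exact absurd (hq ▸ h0) (hw.row_ne_zero t hjN hju)
    · rw [Function.update_of_ne htj] at h0
      exact h.price_free t ht htj h0
  · by_cases htj : t = j
    · subst htj
      rw [Function.update_self, hq]
      exact hw.cheapest t ht hju t' ht'
    · rw [Function.update_of_ne htj] at h0 ⊢
      exact h.cheapest t ht htj h0 t' ht'
  · have htj : t ≠ j := by
      rcases ht with ht | ht
      · omega
      · rintro rfl
        omega
    rw [Function.update_of_ne htj]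
    refine h.ahead t ?_
    rcases hway with h1 | ⟨h1, h2, h3⟩ <;> rcases ht with ht | ht <;> omega

/-- When the hole has reached the auxiliary column, all rows are matched to proper columns. -/
theorem Augment.matching {i : ℕ} {p q : ℕ → ℕ} {v : ℕ → ℝ} {used : ℕ → ℕ}
    (h : Augment N c i p v used q N) (hv : ∀ t < N, v t ≤ 0) : Matching N c i q v where
  le t ht := h.le t ht.le
  inj t ht t' ht' := h.inj t ht.le t' ht'.le ht.ne ht'.ne
  surj r hr hri := by
    obtain ⟨t, ht, htN, hq⟩ := h.surj r hr hri
    exact ⟨t, lt_of_le_of_ne ht htN, hq⟩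
  price_nonpos := hv
  price_free t ht := h.price_free t ht ht.ne
  cheapest t ht := h.cheapest t ht ht.ne

theorem Matching.congr {i : ℕ} {p q : ℕ → ℕ} {v : ℕ → ℝ} (h : Matching N c i p v)
    (hq : ∀ t < N, q t = p t) : Matching N c i q v where
  le t ht := hq t ht ▸ h.le t ht
  inj t ht t' ht' := by
    rw [hq t ht, hq t' ht']
    exact h.inj t ht t' ht'
  surj r hr hri := by
    obtain ⟨t, ht, hp⟩ := h.surj r hr hri
    exact ⟨t, ht, (hq t ht).trans hp⟩
  price_nonpos := h.price_nonpos
  price_free t ht := hq t ht ▸ h.price_free t ht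
  cheapest t ht := hq t ht ▸ h.cheapest t ht

/-- The change of the prices after the search has reached the free column `j`: afterwards the old
matching still puts every row into a cheapest column, and so does the augmenting path. -/
theorem Search.finish {i k j : ℕ} {p : ℕ → ℕ} {v v' dist : ℕ → ℝ} {way used : ℕ → ℕ}
    (hm : Matching N c i p v) (h : Search N c (i + 1) p v k dist way used)
    (hj : Nearest N dist used j) (hpj : p j = 0) (hpN : p N = i + 1)
    (hv : ∀ t < N, v' t =
      if Function.update used j (k + 1) t = 0 then v t else v t - (dist j - dist t)) :
    (∀ t < N, v' t ≤ 0) ∧ Path N c p v' way (Function.update used j (k + 1)) ∧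
      Augment N c (i + 1) p v' (Function.update used j (k + 1)) p j := by
  obtain ⟨hjN, hju, hmin⟩ := hj
  have hself : Function.update used j (k + 1) j = k + 1 := Function.update_self ..
  have hnej : ∀ {w}, used w ≠ 0 → w ≠ j := by
    rintro w hw rfl
    exact hw hju
  have hold : ∀ {w}, used w ≠ 0 → Function.update used j (k + 1) w = used w := fun hw =>
    Function.update_of_ne (hnej hw) _ _
  -- the prices of visited and of unvisited columns
  have hvu : ∀ {t}, t < N → used t ≠ 0 → v' t = v t - (dist j - dist t) := fun {t} ht hu => by
    rw [hv t ht, if_neg (by rwa [hold hu])]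
  have hvn : ∀ {t}, t < N → used t = 0 → v' t = v t := fun {t} ht hu => by
    rw [hv t ht]
    by_cases htj : t = j
    · rw [htj]
      simp
    · rw [Function.update_of_ne htj, if_pos hu]
  have hle : ∀ {t}, t < N → v' t ≤ v t := fun {t} ht => by
    by_cases hu : used t = 0
    · exact (hvn ht hu).le
    · rw [hvu ht hu]
      linarith [h.mono t ht hu j hjN hju]
  have hcheap : ∀ t < N, p t ≠ 0 → ∀ t' < N, c (p t) t - v' t ≤ c (p t) t' - v' t' := by
    intro t ht hp t' ht'
    by_cases hu : used t = 0
    · rw [hvn ht hu]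
      linarith [hm.cheapest t ht hp t' ht', hle ht']
    · rw [hvu ht hu]
      have hs := h.le_step t ht hu t' ht'
      by_cases hu' : used t' = 0
      · rw [hvn ht' hu']
        linarith [hmin t' ht' hu']
      · rw [hvu ht' hu']
        linarith
  have hvway : ∀ t < N, Function.update used j (k + 1) t ≠ 0 →
      v' t = v t - (dist j - dist t) := fun t ht hu => by
    rw [hv t ht, if_neg hu]
  have hback : ∀ t < N, Function.update used j (k + 1) t ≠ 0 → used (way t) ≠ 0 →
      way t < N → (used t = 0 ∨ used (way t) < used t) →
      used (way t) < Function.update used j (k + 1) t := by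
    intro t ht hu hw hwN hlt
    by_cases htj : t = j
    · rw [htj] at hwN ⊢
      rw [hself]
      have := h.used_le _ hwN
      omega
    · rw [Function.update_of_ne htj] at hu ⊢
      exact hlt.resolve_left hu
  refine ⟨fun t ht => (hle ht).trans (hm.price_nonpos t ht), ⟨fun t ht hu => ?_,
    fun t ht hu => ?_, fun t ht hu t' ht' => ?_⟩, ⟨Or.inr ⟨hjN, by omega⟩, fun t ht => ?_,
    fun t ht t' ht' htj htj' he h0 => ?_, fun r hr hri => ?_, fun t ht htj h0 => ?_,
    fun t ht htj h0 => hcheap t ht h0, fun t ht => rfl⟩⟩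
  · rcases h.way t ht with h1 | ⟨h1, h2, h3, -⟩
    · exact Or.inl h1.1
    · refine Or.inr ⟨h1, ?_⟩
      rw [hold h2]
      exact ⟨h2, hback t ht hu h2 h1 h3⟩
  · rcases h.way t ht with h1 | ⟨h1, h2, -, -⟩
    · rw [h1.1, hpN]
      omega
    · exact h.matched _ h1 h2
  · rcases h.way t ht with ⟨h1, h2⟩ | ⟨h1, h2, -, h4⟩
    · rw [h1, hpN, hvway t ht hu]
      have hd := h.le_direct t' ht'
      by_cases hu' : used t' = 0
      · rw [hvn ht' hu']
        linarith [hmin t' ht' hu']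
      · rw [hvu ht' hu']
        linarith
    · have := hcheap _ h1 (h.matched _ h1 h2) t' ht'
      rw [hvu h1 h2] at this
      rw [hvway t ht hu]
      linarith
  · rcases ht.eq_or_lt with rfl | ht
    · exact hpN.le
    · exact (hm.le t ht).trans (Nat.le_succ _)
  · rcases ht.eq_or_lt with rfl | ht <;> rcases ht'.eq_or_lt with rfl | ht'
    · rfl
    · have := hm.le t' ht'
      omega
    · have := hm.le t ht
      omega
    · exact hm.inj t ht t' ht' he h0
  · by_cases hri' : r = i + 1
    · exact ⟨N, le_rfl, by omega, hpN.trans hri'.symm⟩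
    · obtain ⟨t, ht, hp⟩ := hm.surj r hr (by omega)
      refine ⟨t, ht.le, ?_, hp⟩
      rintro rfl
      omega
  · have hu : used t = 0 := by
      by_contra hu
      exact h.matched t ht hu h0
    rw [hvn ht hu]
    exact hm.price_free t ht h0

/-- The matching has minimum cost among all injective placements `q` of the rows into the
columns: the prices of the columns that it does not use are zero and the others are at most
zero. -/
theorem Matching.sum_le {n : ℕ} {p : ℕ → ℕ} {v : ℕ → ℝ} (h : Matching N c n p v)
    {m q : Fin n → Fin N} (hpm : ∀ r, p (m r) = r + 1) (hq : Function.Injective q) :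
    ∑ r : Fin n, c (r + 1) (m r) ≤ ∑ r : Fin n, c (r + 1) (q r) := by
  have hm : Function.Injective m := by
    intro r r' he
    have h1 := hpm r
    rw [he, hpm r'] at h1
    exact Fin.ext (by omega)
  have h1 : ∑ r : Fin n, c (r + 1) (m r) + ∑ r : Fin n, v (q r)
      ≤ ∑ r : Fin n, c (r + 1) (q r) + ∑ r : Fin n, v (m r) := by
    rw [← Finset.sum_add_distrib, ← Finset.sum_add_distrib]
    refine Finset.sum_le_sum fun r _ => ?_
    have := h.cheapest (m r) (m r).2 (by rw [hpm r]; omega) (q r) (q r).2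
    rw [hpm r] at this
    linarith
  have h2 : ∑ r : Fin n, v (m r) = ∑ t : Fin N, v t := by
    rw [← Finset.sum_image (f := fun t : Fin N => v t) (fun _ _ _ _ he => hm he)]
    refine Finset.sum_subset (Finset.subset_univ _) fun t _ ht => ?_
    refine h.price_free t t.2 ?_
    by_contra h0
    have hle := h.le t t.2
    refine ht (Finset.mem_image.2 ⟨⟨p t - 1, by omega⟩, Finset.mem_univ _, Fin.ext ?_⟩)
    have := hpm ⟨p t - 1, by omega⟩
    refine h.inj _ (Fin.is_lt _) _ t.2 ?_ ?_ <;> simp only [this] <;> omega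
  have h3 : ∑ t : Fin N, v t ≤ ∑ r : Fin n, v (q r) := by
    rw [← Finset.sum_image (f := fun t : Fin N => v t) (fun _ _ _ _ he => hq he)]
    rw [← Finset.sum_add_sum_compl (Finset.univ.image q) fun t : Fin N => v t]
    have := Finset.sum_nonpos (s := (Finset.univ.image q)ᶜ) (f := fun t : Fin N => v t)
      fun t _ => h.price_nonpos t t.2
    linarith
  linarith

end Hungarian

namespace Hungarian

open RealRAM

/-! ### The program -/

-- Natural number variables and arrays, then real arrays. Rows are numbered from `1`, so that row
-- `r` is source `r - 1` and `0` in `rowArr` marks a free column.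
notation "slotsVar" => (10 : ℕ)
notation "rowVar" => (11 : ℕ)
notation "colVar" => (12 : ℕ)
notation "curVar" => (13 : ℕ)
notation "timeVar" => (14 : ℕ)
notation "sinkArr" => (20 : ℕ)
notation "rowArr" => (21 : ℕ)
notation "wayArr" => (22 : ℕ)
notation "usedArr" => (23 : ℕ)
notation "priceArr" => (10 : ℕ)
notation "distArr" => (11 : ℕ)

/-- The square of the difference of two real numbers. -/
def sqDiffE (x y : RExp) : RExp := .mul (.sub x y) (.sub x y)

/-- The distance of source `r - 1` to the sink of slot `t`. -/
def costE (r t : NExp) : RExp :=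
  .sqrt (.add
    (sqDiffE (.get 1 (.sub r (.const 1))) (.get 3 (.get sinkArr t)))
    (sqDiffE (.get 2 (.sub r (.const 1))) (.get 4 (.get sinkArr t))))

/-- The reduced cost of row `r` in column `t`. -/
def redE (r t : NExp) : RExp := .sub (costE r t) (.get priceArr t)

/-- The length of the path to column `t` through the current column. -/
def candE : RExp :=
  .sub (.add (.get distArr (.var curVar)) (redE (.get rowArr (.var curVar)) (.var colVar)))
    (redE (.get rowArr (.var curVar)) (.var curVar))

/-- The distances of the columns from the new row, without intermediate columns. -/
def initProg : Prog :=
  forN colVar (.var slotsVar)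
    (.seq (.setReal distArr (.var colVar)
      (redE (.add (.var rowVar) (.const 1)) (.var colVar)))
    (.seq (.setNat wayArr (.var colVar) (.var slotsVar))
      (.setNat usedArr (.var colVar) (.const 0))))

/-- The current column becomes the nearest unvisited column. -/
def nearestProg : Prog :=
  .seq (.setNat curVar (.const 0) (.var slotsVar))
    (forN colVar (.var slotsVar)
      (.ite (.and (.nle (.get usedArr (.var colVar)) (.const 0))
          (.not (.and (.nle (.add (.var curVar) (.const 1)) (.var slotsVar))
            (.rle (.get distArr (.var curVar)) (.get distArr (.var colVar))))))
        (.setNat curVar (.const 0) (.var colVar)) .skip))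

/-- The distances of the unvisited columns are updated with the paths through the current
column. -/
def relaxProg : Prog :=
  forN colVar (.var slotsVar)
    (.ite (.and (.nle (.get usedArr (.var colVar)) (.const 0))
        (.not (.rle (.get distArr (.var colVar)) candE)))
      (.seq (.setReal distArr (.var colVar) candE)
        (.setNat wayArr (.var colVar) (.var curVar)))
      .skip)

/-- The current column is visited at the next time step. -/
def markProg : Prog :=
  .seq (.setNat timeVar (.const 0) (.add (.var timeVar) (.const 1)))
    (.setNat usedArr (.var curVar) (.var timeVar))

/-- Dijkstra's algorithm, until the current column is free. -/
def searchProg : Prog :=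
  .seq initProg (.seq (.setNat timeVar (.const 0) (.const 0)) (.seq nearestProg
    (.loop (.not (.nle (.get rowArr (.var curVar)) (.const 0)))
      (.seq markProg (.seq relaxProg nearestProg)))))

/-- The prices of the visited columns fall by what their distances lack to the distance of the
current column. -/
def priceProg : Prog :=
  forN colVar (.var slotsVar)
    (.ite (.nle (.get usedArr (.var colVar)) (.const 0)) .skip
      (.setReal priceArr (.var colVar)
        (.sub (.get priceArr (.var colVar))
          (.sub (.get distArr (.var curVar)) (.get distArr (.var colVar))))))

/-- The rows on the augmenting path move to the next column, starting from its free end. -/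
def augmentProg : Prog :=
  .loop (.not (.nle (.var slotsVar) (.var curVar)))
    (.seq (.setNat rowArr (.var curVar) (.get rowArr (.get wayArr (.var curVar))))
      (.setNat curVar (.const 0) (.get wayArr (.var curVar))))

/-- A further row is matched. During the phase the auxiliary column `N` carries the new row, so that
the augmenting path also begins in a column. -/
def phaseProg : Prog :=
  .seq (.setNat rowArr (.var slotsVar) (.add (.var rowVar) (.const 1)))
    (.seq searchProg (.seq markProg (.seq priceProg augmentProg)))

/-- The number of slots, which is the capacity times the number of sinks. -/
def countProg : Prog :=
  forN colVar (.get 0 (.const 1))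
    (.setNat slotsVar (.const 0) (.add (.var slotsVar) (.get 1 (.const 0))))

/-- Slot `t` belongs to the sink `t % numSinks`. -/
def sinksProg : Prog :=
  forN colVar (.var slotsVar)
    (.ite (.nle (.get 0 (.const 1)) (.var colVar))
      (.setNat sinkArr (.var colVar) (.get sinkArr (.sub (.var colVar) (.get 0 (.const 1)))))
      (.setNat sinkArr (.var colVar) (.var colVar)))

/-- The sources are matched to slots, one after the other. -/
def matchProg : Prog := forN rowVar (.get 0 (.const 0)) phaseProg

/-- The parent pointers of the forest of stars that is given by the matching. -/
def outputProg : Prog :=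
  forN colVar (.var slotsVar)
    (.ite (.nle (.get rowArr (.var colVar)) (.const 0)) .skip
      (.seq (.setNat 3 (.sub (.get rowArr (.var colVar)) (.const 1))
          (.add (.add (.get 0 (.const 0)) (.get sinkArr (.var colVar))) (.const 2)))
        (.setNat 3 (.add (.get 0 (.const 0)) (.get sinkArr (.var colVar))) (.const 1))))

/-- The program that solves FLaMECaST for `α = 1` and for instances without intermediate layers. If
there are fewer slots than sources, it leaves the answer `0` that the memory contains from the
start. -/
def solver : Prog :=
  .seq countProg
    (.ite (.nle (.get 0 (.const 0)) (.var slotsVar))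
      (.seq sinksProg (.seq matchProg (.seq outputProg (.setNat 2 (.const 0) (.const 1)))))
      .skip)

/-- The memory `s` holds the number `N` of columns and data that determine the cost `c`. -/
structure Data (N : ℕ) (c : ℕ → ℕ → ℝ) (s : State) : Prop where
  slots : s.nat slotsVar 0 = N
  cost : ∀ r t, (costE (.const r) (.const t)).eval s = c r t

variable {N : ℕ} {c : ℕ → ℕ → ℝ} {s : State}

theorem costE_eval (s : State) (r t : NExp) :
    (costE r t).eval s = (costE (.const (r.eval s)) (.const (t.eval s))).eval s := by
  simp [costE, sqDiffE, RExp.eval, NExp.eval]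

theorem Data.redE_eval (h : Data N c s) (r t : NExp) :
    (redE r t).eval s = c (r.eval s) (t.eval s) - s.real priceArr (t.eval s) := by
  simp only [redE, RExp.eval]
  rw [costE_eval, h.cost]

theorem Data.candE_eval (h : Data N c s) :
    candE.eval s = s.real distArr (s.nat curVar 0)
      + (c (s.nat rowArr (s.nat curVar 0)) (s.nat colVar 0) - s.real priceArr (s.nat colVar 0))
      - (c (s.nat rowArr (s.nat curVar 0)) (s.nat curVar 0)
        - s.real priceArr (s.nat curVar 0)) := by
  simp only [candE, RExp.eval, h.redE_eval, NExp.eval]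

theorem Data.frame {A B : List ℕ} {s' : State} (h : Data N c s) (hF : Frame A B s s')
    (hA : slotsVar ∉ A ∧ sinkArr ∉ A) (hB : 1 ∉ B ∧ 2 ∉ B ∧ 3 ∉ B ∧ 4 ∉ B) : Data N c s' := by
  refine ⟨by rw [hF.nat _ hA.1, h.slots], fun r t => ?_⟩
  rw [← h.cost r t]
  simp [costE, sqDiffE, RExp.eval, NExp.eval, hF.nat _ hA.2, hF.real _ hB.1, hF.real _ hB.2.1,
    hF.real _ hB.2.2.1, hF.real _ hB.2.2.2]

/-! ### Verification of the program -/

/-- The constants in this and the following time bounds are convenient round numbers and not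
optimal. -/
theorem initProg_runs (h : Data N c s) :
    Runs initProg s (N * 200 + 100) fun s' => Frame [colVar, wayArr, usedArr] [distArr] s s' ∧
      ∀ t < N, s'.real distArr t = c (s.nat rowVar 0 + 1) t - s.real priceArr t ∧
        s'.nat wayArr t = N ∧ s'.nat usedArr t = 0 := by
  refine Runs.forN (N := N) (T := 150)
    (I := fun k s' => s'.nat colVar 0 = k ∧
      Frame [colVar, wayArr, usedArr] [distArr] s s' ∧
      ∀ t < k, s'.real distArr t = c (s.nat rowVar 0 + 1) t - s.real priceArr t ∧
        s'.nat wayArr t = N ∧ s'.nat usedArr t = 0)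
    ⟨by simp, (Frame.refl ..).setNat _ _ (by simp), by simp⟩ (fun k s' h => h.1)
    (fun k s' hI => ?_) (fun k s' hk hI => ?_) (fun s' hI => hI.2) ?_
  · simp [NExp.eval, hI.2.1.nat, h.slots]
  · obtain ⟨hcol, hF, hI⟩ := hI
    have hd := h.frame hF (by simp) (by simp)
    refine Runs.seq_setReal (T₂ := 50) ?_ (by decide)
    refine Runs.seq_setNat (T₂ := 40) ?_ (by decide)
    refine Runs.setNat (by decide) ⟨by simp [hcol], by simp,
      (((hF.setReal _ _ (by simp)).setNat _ _ (by simp)).setNat _ _ (by simp)).setNat _ _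
        (by simp), fun t ht => ?_⟩
    simp only [hd.redE_eval]
    rcases Nat.lt_succ_iff_lt_or_eq.1 ht with ht | rfl
    · simp [NExp.eval, hcol, ht.ne, hI t ht]
    · simp [NExp.eval, hcol, hd.slots, hF.nat, hF.real]
  · simp only [NExp.time]
    omega

theorem nearestProg_runs (h : Data N c s) :
    Runs nearestProg s (N * 200 + 110) fun s' => Frame [colVar, curVar] [] s s' ∧
      ((∃ t < N, s.nat usedArr t = 0) →
        Nearest N (s.real distArr) (s.nat usedArr) (s'.nat curVar 0)) := by
  refine Runs.seq_setNat (T₂ := N * 200 + 105) ?_ (by simp only [NExp.time]; omega)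
  refine Runs.forN (N := N) (T := 150)
    (I := fun k s' => s'.nat colVar 0 = k ∧ Frame [colVar, curVar] [] s s' ∧
      ((s'.nat curVar 0 = N ∧ ∀ t < k, s.nat usedArr t ≠ 0) ∨
        (s'.nat curVar 0 < k ∧ s.nat usedArr (s'.nat curVar 0) = 0 ∧
          ∀ t < k, s.nat usedArr t = 0 → s.real distArr (s'.nat curVar 0) ≤ s.real distArr t)))
    ⟨by simp, ((Frame.refl ..).setNat _ _ (by simp)).setNat _ _ (by simp),
      Or.inl ⟨by simp [NExp.eval, h.slots], by simp⟩⟩ (fun k s' h => h.1)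
    (fun k s' hI => ?_) (fun k s' hk hI => ?_) (fun s' hI => ⟨hI.2.1, ?_⟩) ?_
  · simp [NExp.eval, hI.2.1.nat, h.slots]
  · obtain ⟨hcol, hF, hI⟩ := hI
    have hF' : Frame [colVar, curVar] [] s (s'.setNat colVar 0 (k + 1)) :=
      hF.setNat _ _ (by simp)
    have hcur : (s'.setNat colVar 0 (k + 1)).nat curVar = s'.nat curVar := by simp
    refine Runs.ite (T := 50) (fun hb => ?_) (fun hb => ?_) (by decide)
    · simp only [BExp.Holds, NExp.eval, RExp.eval, hcol, hF.nat usedArr (by simp),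
        hF.nat slotsVar (by simp), h.slots, hF.real distArr (by simp), Nat.le_zero] at hb
      refine Runs.setNat (by decide) ⟨by simp [hcol], by simp,
        (hF.setNat _ _ (by simp)).setNat _ _ (by simp), Or.inr ?_⟩
      have hcur' : ((s'.setNat curVar (NExp.eval s' (.const 0))
          (NExp.eval s' (.var colVar))).setNat colVar 0 (k + 1)).nat curVar 0 = k := by
        simp [NExp.eval, hcol]
      rw [hcur']
      refine ⟨Nat.lt_succ_self k, hb.1, fun t ht hu => ?_⟩
      rcases Nat.lt_succ_iff_lt_or_eq.1 ht with ht | rfl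
      · rcases hI with ⟨-, hI⟩ | ⟨h1, h2, h3⟩
        · exact absurd hu (hI t ht)
        · have : ¬ s.real distArr (s'.nat curVar 0) ≤ s.real distArr k :=
            fun hle => hb.2 ⟨by omega, hle⟩
          exact (not_le.1 this).le.trans (h3 t ht hu)
      · exact le_rfl
    · simp only [BExp.Holds, NExp.eval, RExp.eval, hcol, hF.nat usedArr (by simp),
        hF.nat slotsVar (by simp), h.slots, hF.real distArr (by simp), Nat.le_zero] at hb
      have hb := fun hu => not_not.1 fun hn => hb ⟨hu, hn⟩
      refine Runs.skip (by simp) ⟨hcol, by simp, hF', ?_⟩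
      rw [hcur]
      rcases hI with ⟨h0, h1⟩ | ⟨h1, h2, h3⟩
      · refine Or.inl ⟨h0, fun t ht hu => ?_⟩
        rcases Nat.lt_succ_iff_lt_or_eq.1 ht with ht | rfl
        · exact h1 t ht hu
        · have := (hb hu).1
          omega
      · refine Or.inr ⟨by omega, h2, fun t ht hu => ?_⟩
        rcases Nat.lt_succ_iff_lt_or_eq.1 ht with ht | rfl
        · exact h3 t ht hu
        · exact (hb hu).2
  · rintro ⟨t, ht, hu⟩
    exact hI.2.2.resolve_left fun hn => hn.2 t ht hu
  · simp only [NExp.time]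
    omega

/-- The current column is visited, so its distance does not change while the others are relaxed. -/
theorem relaxProg_runs (h : Data N c s) (hu : s.nat usedArr (s.nat curVar 0) ≠ 0)
    {cand : ℕ → ℝ} (hc : ∀ t, cand t = s.real distArr (s.nat curVar 0)
      + (c (s.nat rowArr (s.nat curVar 0)) t - s.real priceArr t)
      - (c (s.nat rowArr (s.nat curVar 0)) (s.nat curVar 0)
        - s.real priceArr (s.nat curVar 0))) :
    Runs relaxProg s (N * 500 + 100) fun s' => Frame [colVar, wayArr] [distArr] s s' ∧
      ∀ t < N, RelaxedAt (s.nat usedArr) (s.nat curVar 0) cand (s.real distArr) (s'.real distArr)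
        (s.nat wayArr) (s'.nat wayArr) t := by
  refine Runs.forN (N := N) (T := 400)
    (I := fun k s' => s'.nat colVar 0 = k ∧ Frame [colVar, wayArr] [distArr] s s' ∧
      (∀ t, k ≤ t ∨ t = s.nat curVar 0 →
        s'.real distArr t = s.real distArr t ∧ s'.nat wayArr t = s.nat wayArr t) ∧
      ∀ t < k, RelaxedAt (s.nat usedArr) (s.nat curVar 0) cand (s.real distArr) (s'.real distArr)
        (s.nat wayArr) (s'.nat wayArr) t)
    ⟨by simp, (Frame.refl ..).setNat _ _ (by simp), by simp, by simp⟩ (fun k s' h => h.1)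
    (fun k s' hI => ?_) (fun k s' hk hI => ?_) (fun s' hI => ⟨hI.2.1, hI.2.2.2⟩) ?_
  · simp [NExp.eval, hI.2.1.nat, h.slots]
  · obtain ⟨hcol, hF, hsame, hI⟩ := hI
    have hd := h.frame hF (by simp) (by simp)
    have hF' : Frame [colVar, wayArr] [distArr] s (s'.setNat colVar 0 (k + 1)) :=
      hF.setNat _ _ (by simp)
    have hcand : candE.eval s' = cand k := by
      rw [hd.candE_eval, hc, hF.nat curVar (by simp), hF.nat rowArr (by simp),
        hF.real priceArr (by simp), hcol, (hsame _ (Or.inr rfl)).1]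
    have hdist : s'.real distArr k = s.real distArr k := (hsame k (Or.inl le_rfl)).1
    refine Runs.ite (T := 200) (fun hb => ?_) (fun hb => ?_) (by decide)
    · simp only [BExp.Holds, NExp.eval, RExp.eval, hcol, hF.nat usedArr (by simp),
        Nat.le_zero, hcand, hdist, not_le] at hb
      have hkc : k ≠ s.nat curVar 0 := by
        rintro rfl
        exact hu hb.1
      refine Runs.seq_setReal (T₂ := 50) ?_ (by decide)
      refine Runs.setNat (by decide) ⟨by simp [hcol], by simp,
        ((hF.setReal _ _ (by simp)).setNat _ _ (by simp)).setNat _ _ (by simp),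
        fun t ht => ?_, fun t ht => ?_⟩
      · have htk : t ≠ k := by omega
        simpa [NExp.eval, hcol, htk] using hsame t (by omega)
      · rcases Nat.lt_succ_iff_lt_or_eq.1 ht with ht | rfl
        · simpa [RelaxedAt, NExp.eval, hcol, ht.ne] using hI t ht
        · left
          simp [NExp.eval, hcol, hb, hcand, hF.nat]
    · simp only [BExp.Holds, NExp.eval, RExp.eval, hcol, hF.nat usedArr (by simp),
        Nat.le_zero, hcand, hdist, not_le] at hb
      refine Runs.skip (by simp) ⟨hcol, by simp, hF', fun t ht => ?_, fun t ht => ?_⟩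
      · simpa using hsame t (by omega)
      · rcases Nat.lt_succ_iff_lt_or_eq.1 ht with ht | rfl
        · simpa using hI t ht
        · exact Or.inr ⟨hb, by simpa using hsame t (Or.inl le_rfl)⟩
  · simp only [NExp.time]
    omega

theorem priceProg_runs (h : Data N c s) :
    Runs priceProg s (N * 200 + 100) fun s' => Frame [colVar] [priceArr] s s' ∧
      ∀ t < N, s'.real priceArr t =
        if s.nat usedArr t = 0 then s.real priceArr t
        else s.real priceArr t - (s.real distArr (s.nat curVar 0) - s.real distArr t) := by
  refine Runs.forN (N := N) (T := 150)
    (I := fun k s' => s'.nat colVar 0 = k ∧ Frame [colVar] [priceArr] s s' ∧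
      (∀ t, k ≤ t → s'.real priceArr t = s.real priceArr t) ∧
      ∀ t < k, s'.real priceArr t =
        if s.nat usedArr t = 0 then s.real priceArr t
        else s.real priceArr t - (s.real distArr (s.nat curVar 0) - s.real distArr t))
    ⟨by simp, (Frame.refl ..).setNat _ _ (by simp), by simp, by simp⟩ (fun k s' h => h.1)
    (fun k s' hI => ?_) (fun k s' hk hI => ?_) (fun s' hI => ⟨hI.2.1, hI.2.2.2⟩) ?_
  · simp [NExp.eval, hI.2.1.nat, h.slots]
  · obtain ⟨hcol, hF, hsame, hI⟩ := hI
    have hF' : Frame [colVar] [priceArr] s (s'.setNat colVar 0 (k + 1)) :=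
      hF.setNat _ _ (by simp)
    refine Runs.ite (T := 100) (fun hb => ?_) (fun hb => ?_) (by decide)
    · simp only [BExp.Holds, NExp.eval, hcol, hF.nat usedArr (by simp), Nat.le_zero] at hb
      refine Runs.skip (by simp) ⟨hcol, by simp, hF', fun t ht => ?_, fun t ht => ?_⟩
      · simpa using hsame t (by omega)
      · rcases Nat.lt_succ_iff_lt_or_eq.1 ht with ht | rfl
        · simpa using hI t ht
        · simpa [hb] using hsame t le_rfl
    · simp only [BExp.Holds, NExp.eval, hcol, hF.nat usedArr (by simp), Nat.le_zero] at hb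
      refine Runs.setReal (by decide) ⟨by simp [hcol], by simp,
        (hF.setReal _ _ (by simp)).setNat _ _ (by simp), fun t ht => ?_, fun t ht => ?_⟩
      · have htk : t ≠ k := by omega
        simpa [NExp.eval, hcol, htk] using hsame t (by omega)
      · rcases Nat.lt_succ_iff_lt_or_eq.1 ht with ht | rfl
        · simpa [NExp.eval, hcol, ht.ne] using hI t ht
        · simp [NExp.eval, RExp.eval, hcol, hb, hF.nat, hF.real, hsame t le_rfl]
  · simp only [NExp.time]
    omega

theorem markProg_runs (s : State) :
    Runs markProg s 20 fun s' => Frame [timeVar, usedArr] [] s s' ∧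
      s'.nat timeVar 0 = s.nat timeVar 0 + 1 ∧
      s'.nat usedArr = Function.update (s.nat usedArr) (s.nat curVar 0) (s.nat timeVar 0 + 1) := by
  refine Runs.seq_setNat (T₂ := 10) (Runs.setNat (by decide)
    ⟨((Frame.refl ..).setNat _ _ (by simp)).setNat _ _ (by simp), ?_, ?_⟩) (by decide)
  · simp [NExp.eval]
  · simp [NExp.eval]

theorem searchProg_runs {i : ℕ} (h : Data N c s)
    (hm : Matching N c i (s.nat rowArr) (s.real priceArr)) (hi : i < N)
    (hrow : s.nat rowVar 0 = i) :
    Runs searchProg s ((N + 1) * (N + 1) * 1000) fun s' =>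
      Frame [colVar, wayArr, usedArr, curVar, timeVar] [distArr] s s' ∧
      Search N c (i + 1) (s.nat rowArr) (s.real priceArr) (s'.nat timeVar 0) (s'.real distArr)
        (s'.nat wayArr) (s'.nat usedArr) ∧
      Nearest N (s'.real distArr) (s'.nat usedArr) (s'.nat curVar 0) ∧
      s.nat rowArr (s'.nat curVar 0) = 0 := by
  refine Runs.seq (initProg_runs h) (fun s₁ ⟨hF₁, h₁⟩ => ?_)
    (T₂ := N * (N * 700 + 250) + N * 200 + 150) (by nlinarith)
  refine Runs.seq_setNat (T₂ := N * (N * 700 + 250) + N * 200 + 140) ?_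
    (by simp only [NExp.time]; omega)
  have hF₂ : Frame [colVar, wayArr, usedArr, curVar, timeVar] [distArr] s
      (s₁.setNat timeVar 0 0) :=
    (hF₁.mono (by simp) (by simp)).setNat _ _ (by simp)
  have hS₂ : Search N c (i + 1) (s.nat rowArr) (s.real priceArr) 0
      ((s₁.setNat timeVar 0 0).real distArr) ((s₁.setNat timeVar 0 0).nat wayArr)
      ((s₁.setNat timeVar 0 0).nat usedArr) := by
    refine Search.init (fun t ht => ?_) (fun t ht => ?_) (fun t ht => ?_)
    · simpa [hrow] using (h₁ t ht).1
    · simpa using (h₁ t ht).2.1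
    · simpa using (h₁ t ht).2.2
  refine Runs.seq (nearestProg_runs (h.frame hF₂ (by simp) (by simp)))
    (fun s₃ ⟨hF₃, h₃⟩ => ?_) (T₂ := N * (N * 700 + 250) + 30) (by omega)
  refine Runs.loop (n := N) (T := N * 700 + 230) (I := fun k s' =>
      Frame [colVar, wayArr, usedArr, curVar, timeVar] [distArr] s s' ∧
      s'.nat timeVar 0 = k ∧
      Search N c (i + 1) (s.nat rowArr) (s.real priceArr) k (s'.real distArr)
        (s'.nat wayArr) (s'.nat usedArr) ∧
      Nearest N (s'.real distArr) (s'.nat usedArr) (s'.nat curVar 0))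
    ⟨(hF₂.trans hF₃).mono (by simp) (by simp), by simp [hF₃.nat, NExp.eval], ?_, ?_⟩ ?_ ?_ ?_
  · rwa [hF₃.nat _ (by simp), hF₃.nat _ (by simp), hF₃.real _ (by simp)]
  · rw [hF₃.nat usedArr (by simp), hF₃.real _ (by simp)]
    exact h₃ (hS₂.exists_unused hm hi)
  · rintro k s' ⟨hF, htime, hS, hN⟩ hg
    simp only [BExp.Holds, NExp.eval, Nat.le_zero, hF.nat rowArr (by simp)] at hg
    refine ⟨hS.lt hN.1 hN.2.1, ?_⟩
    refine Runs.seq (markProg_runs s') (fun s₄ ⟨hF₄, ht₄, hu₄⟩ => ?_)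
      (T₂ := N * 700 + 210) (by omega)
    have hd₄ := (h.frame hF (by simp) (by simp)).frame hF₄ (by simp) (by simp)
    have hcur₄ := hF₄.nat curVar (by simp)
    refine Runs.seq (relaxProg_runs hd₄ ?_ fun t => rfl) (fun s₅ ⟨hF₅, h₅⟩ => ?_)
      (T₂ := N * 200 + 110) (by omega)
    · rw [hcur₄, hu₄]
      simp
    refine (nearestProg_runs (hd₄.frame hF₅ (by simp) (by simp))).mono le_rfl
      fun s₆ ⟨hF₆, h₆⟩ => ?_
    rw [hcur₄, hu₄, htime, hF₄.real _ (by simp), hF₄.nat wayArr (by simp),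
      hF₄.real priceArr (by simp), hF₄.nat rowArr (by simp), hF.nat rowArr (by simp),
      hF.real priceArr (by simp)] at h₅
    have hS' := hS.step hm hN hg (fun t => rfl) h₅
    have hu₅ : s₅.nat usedArr = Function.update (s'.nat usedArr) (s'.nat curVar 0) (k + 1) := by
      rw [hF₅.nat _ (by simp), hu₄, htime]
    rw [hu₅] at h₆
    refine ⟨(((hF.trans hF₄).trans hF₅).trans hF₆).mono (by simp) (by simp), ?_, ?_, ?_⟩
    · rw [hF₆.nat _ (by simp), hF₅.nat _ (by simp), ht₄, htime]
    · rwa [hF₆.nat _ (by simp), hF₆.nat _ (by simp), hF₆.real _ (by simp), hu₅]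
    · rw [hF₆.nat usedArr (by simp), hF₆.real _ (by simp), hu₅]
      exact h₆ (hS'.exists_unused hm hi)
  · rintro k s' ⟨hF, rfl, hS, hN⟩ hg
    simp only [BExp.Holds, NExp.eval, Nat.le_zero, hF.nat rowArr (by simp), not_not] at hg
    exact ⟨hF, hS, hN, hg⟩
  · simp only [BExp.time, NExp.time]
    nlinarith

/-- The time stamps fall along the path, so the augmentation takes at most `N` rounds. -/
theorem augmentProg_runs {i : ℕ} {p : ℕ → ℕ} (hN : s.nat slotsVar 0 = N)
    (ha : Augment N c i p (s.real priceArr) (s.nat usedArr) (s.nat rowArr) (s.nat curVar 0))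
    (hw : Path N c p (s.real priceArr) (s.nat wayArr) (s.nat usedArr))
    (hu : s.nat usedArr (s.nat curVar 0) ≤ N) :
    Runs augmentProg s (N * 100 + 200) fun s' => Frame [rowArr, curVar] [] s s' ∧
      Augment N c i p (s.real priceArr) (s.nat usedArr) (s'.nat rowArr) N := by
  refine Runs.loop (n := N + 1) (T := 50) (I := fun k s' => Frame [rowArr, curVar] [] s s' ∧
      Augment N c i p (s.real priceArr) (s.nat usedArr) (s'.nat rowArr) (s'.nat curVar 0) ∧
      (s'.nat curVar 0 = N ∨ s.nat usedArr (s'.nat curVar 0) + k ≤ N))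
    ⟨Frame.refl .., ha, Or.inr hu⟩ ?_ ?_ ?_
  · rintro k s' ⟨hF, hA, hk⟩ hg
    simp only [BExp.Holds, NExp.eval, hF.nat slotsVar (by simp), hN, not_le] at hg
    refine ⟨by omega, ?_⟩
    refine Runs.seq_setNat (T₂ := 20) ?_ (by decide)
    refine Runs.setNat (by decide)
      ⟨(hF.setNat _ _ (by simp)).setNat _ _ (by simp), ?_, ?_⟩
    · simpa [NExp.eval, hF.nat wayArr] using hA.step hw hg.ne
    · have hju := hA.hole.resolve_left hg.ne
      have := hw.back _ hju.1 hju.2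
      simp only [NExp.eval, State.setNat_nat_self, Function.update_self]
      simp only [hF.nat wayArr, List.mem_cons, Nat.reduceEqDiff, List.not_mem_nil, or_self,
        not_false_eq_true, ne_eq, State.setNat_nat_of_ne]
      omega
  · rintro k s' ⟨hF, hA, -⟩ hg
    simp only [BExp.Holds, NExp.eval, hF.nat slotsVar (by simp), hN, not_not] at hg
    have hj : s'.nat curVar 0 = N := by
      have := hA.hole
      omega
    rw [hj] at hA
    exact ⟨hF, hA⟩
  · simp only [BExp.time, NExp.time]
    omega

theorem phaseProg_runs {i : ℕ} (h : Data N c s)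
    (hm : Matching N c i (s.nat rowArr) (s.real priceArr)) (hi : i < N)
    (hrow : s.nat rowVar 0 = i) :
    Runs phaseProg s ((N + 1) * (N + 1) * 2000) fun s' =>
      Frame [colVar, wayArr, usedArr, curVar, timeVar, rowArr] [distArr, priceArr] s s' ∧
      Matching N c (i + 1) (s'.nat rowArr) (s'.real priceArr) := by
  refine Runs.seq_setNat (T₂ := (N + 1) * (N + 1) * 1000 + (N * 300 + 320)) ?_
    (by simp only [NExp.time]; nlinarith)
  have hev : s.setNat rowArr ((NExp.var slotsVar).eval s)
      (((NExp.var rowVar).add (.const 1)).eval s) = s.setNat rowArr N (i + 1) := by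
    simp [NExp.eval, h.slots, hrow]
  rw [hev]
  have hF₁ : Frame [rowArr] [] s (s.setNat rowArr N (i + 1)) :=
    (Frame.refl ..).setNat _ _ (by simp)
  have hd₁ := h.frame hF₁ (by simp) (by simp)
  have hm₁ : Matching N c i ((s.setNat rowArr N (i + 1)).nat rowArr)
      ((s.setNat rowArr N (i + 1)).real priceArr) := by
    refine hm.congr fun t ht => ?_
    simp [ht.ne]
  have hpN : (s.setNat rowArr N (i + 1)).nat rowArr N = i + 1 := by simp
  have hrow₁ : (s.setNat rowArr N (i + 1)).nat rowVar 0 = i := by simpa using hrow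
  generalize s.setNat rowArr N (i + 1) = s₁ at *
  refine Runs.seq (searchProg_runs hd₁ hm₁ hi hrow₁) (fun s₂ ⟨hF₂, hS, hNear, hfree⟩ => ?_)
    (T₂ := N * 300 + 320) (by omega)
  refine Runs.seq (markProg_runs s₂) (fun s₃ ⟨hF₃, ht₃, hu₃⟩ => ?_)
    (T₂ := N * 300 + 300) (by omega)
  have hd₃ := (hd₁.frame hF₂ (by simp) (by simp)).frame hF₃ (by simp) (by simp)
  refine Runs.seq (priceProg_runs hd₃) (fun s₄ ⟨hF₄, hv₄⟩ => ?_)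
    (T₂ := N * 100 + 200) (by omega)
  have hd₄ := hd₃.frame hF₄ (by simp) (by simp)
  have hcur₄ : s₄.nat curVar = s₂.nat curVar := by
    rw [hF₄.nat _ (by simp), hF₃.nat _ (by simp)]
  have hrow₄ : s₄.nat rowArr = s₁.nat rowArr := by
    rw [hF₄.nat _ (by simp), hF₃.nat _ (by simp), hF₂.nat _ (by simp)]
  have hway₄ : s₄.nat wayArr = s₂.nat wayArr := by
    rw [hF₄.nat _ (by simp), hF₃.nat _ (by simp)]
  have hused₄ : s₄.nat usedArr
      = Function.update (s₂.nat usedArr) (s₂.nat curVar 0) (s₂.nat timeVar 0 + 1) := by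
    rw [hF₄.nat _ (by simp), hu₃]
  rw [hu₃, hF₃.real priceArr (by simp), hF₂.real priceArr (by simp), hF₃.real distArr (by simp),
    hF₃.nat curVar (by simp)] at hv₄
  obtain ⟨hv, hP, hA⟩ := hS.finish hm₁ hNear hfree hpN hv₄
  refine (augmentProg_runs (i := i + 1) (p := s₁.nat rowArr) (c := c) hd₄.slots ?_ ?_ ?_).mono
    le_rfl fun s₅ ⟨hF₅, h₅⟩ => ⟨?_, ?_⟩
  · rwa [hcur₄, hrow₄, hused₄]
  · rwa [hway₄, hused₄]
  · rw [hcur₄, hused₄, Function.update_self]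
    exact hS.lt hNear.1 hNear.2.1
  · exact ((((hF₁.trans hF₂).trans hF₃).trans hF₄).trans hF₅).mono (by simp) (by simp)
  · rw [hF₅.real _ (by simp)]
    exact h₅.matching hv

theorem countProg_runs (h0 : s.nat slotsVar 0 = 0) :
    Runs countProg s (s.nat 0 1 * 100 + 100) fun s' => Frame [colVar, slotsVar] [] s s' ∧
      s'.nat slotsVar 0 = s.nat 1 0 * s.nat 0 1 := by
  refine Runs.forN (N := s.nat 0 1) (T := 50)
    (I := fun k s' => s'.nat colVar 0 = k ∧ Frame [colVar, slotsVar] [] s s' ∧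
      s'.nat slotsVar 0 = s.nat 1 0 * k)
    ⟨by simp, (Frame.refl ..).setNat _ _ (by simp), by simp [h0]⟩ (fun k s' h => h.1)
    (fun k s' hI => ?_) (fun k s' hk hI => ?_) (fun s' hI => hI.2) ?_
  · simp [NExp.eval, hI.2.1.nat]
  · obtain ⟨hcol, hF, hI⟩ := hI
    refine Runs.setNat (by decide) ⟨by simp [hcol], by simp,
      (hF.setNat _ _ (by simp)).setNat _ _ (by simp), ?_⟩
    simp [NExp.eval, hI, hF.nat, Nat.mul_succ]
  · simp only [NExp.time]
    omega

theorem sinksProg_runs (hN : s.nat slotsVar 0 = N) (hk : 0 < N → 0 < s.nat 0 1) :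
    Runs sinksProg s (N * 100 + 100) fun s' => Frame [colVar, sinkArr] [] s s' ∧
      ∀ t < N, s'.nat sinkArr t = t % s.nat 0 1 := by
  refine Runs.forN (N := N) (T := 50)
    (I := fun k s' => s'.nat colVar 0 = k ∧ Frame [colVar, sinkArr] [] s s' ∧
      ∀ t < k, s'.nat sinkArr t = t % s.nat 0 1)
    ⟨by simp, (Frame.refl ..).setNat _ _ (by simp), by simp⟩ (fun k s' h => h.1)
    (fun k s' hI => ?_) (fun k s' hkN hI => ?_) (fun s' hI => hI.2) ?_
  · simp [NExp.eval, hI.2.1.nat, hN]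
  · obtain ⟨hcol, hF, hI⟩ := hI
    have hk := hk (by omega)
    refine Runs.ite (T := 30) (fun hb => ?_) (fun hb => ?_) (by decide) <;>
    simp only [BExp.Holds, NExp.eval, hcol, hF.nat 0 (by simp)] at hb <;>
    refine Runs.setNat (by decide) ⟨by simp [hcol], by simp,
      (hF.setNat _ _ (by simp)).setNat _ _ (by simp), fun t ht => ?_⟩ <;>
    rcases Nat.lt_succ_iff_lt_or_eq.1 ht with ht | rfl
    · simpa [NExp.eval, hcol, ht.ne] using hI t ht
    · simpa [NExp.eval, hcol, hF.nat, ← Nat.mod_eq_sub_mod hb]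
        using hI (t - s.nat 0 1) (by omega)
    · simpa [NExp.eval, hcol, ht.ne] using hI t ht
    · simp [NExp.eval, hcol, Nat.mod_eq_of_lt (not_le.1 hb)]
  · simp only [NExp.time]
    omega

theorem matchProg_runs (h : Data N c s) (hn : s.nat 0 0 ≤ N)
    (hm : Matching N c 0 (s.nat rowArr) (s.real priceArr)) :
    Runs matchProg s ((N + 1) * (N + 1) * (N + 1) * 2100) fun s' =>
      Frame [colVar, wayArr, usedArr, curVar, timeVar, rowArr, rowVar] [distArr, priceArr] s s' ∧
      Matching N c (s.nat 0 0) (s'.nat rowArr) (s'.real priceArr) := by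
  refine Runs.forN (N := s.nat 0 0) (T := (N + 1) * (N + 1) * 2000)
    (I := fun k s' => s'.nat rowVar 0 = k ∧
      Frame [colVar, wayArr, usedArr, curVar, timeVar, rowArr, rowVar] [distArr, priceArr] s s' ∧
      Matching N c k (s'.nat rowArr) (s'.real priceArr))
    ⟨by simp, (Frame.refl ..).setNat _ _ (by simp), by simpa using hm⟩ (fun k s' h => h.1)
    (fun k s' hI => ?_) (fun k s' hk hI => ?_) (fun s' hI => hI.2) ?_
  · simp [NExp.eval, hI.2.1.nat]
  · obtain ⟨hrow, hF, hI⟩ := hI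
    refine (phaseProg_runs (h.frame hF (by simp) (by simp)) hI (by omega) hrow).mono le_rfl
      fun s₁ ⟨hF₁, h₁⟩ => ⟨by rw [hF₁.nat _ (by simp), hrow], by simp,
        ((hF.trans hF₁).mono (by simp) (by simp)).setNat _ _ (by simp), by simpa using h₁⟩
  · simp only [NExp.time]
    have : s.nat 0 0 * ((N + 1) * (N + 1) * 2000 + (1 + 1) + 15)
        ≤ N * ((N + 1) * (N + 1) * 2000 + (1 + 1) + 15) := Nat.mul_le_mul_right _ hn
    nlinarith

/-- The parent pointers that `outputProg` has written after it has seen the columns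
`0, …, k - 1`; `n` is the number of sources, `p t` the row and `sink t` the sink of column `t`. -/
structure Output (n k : ℕ) (p sink out : ℕ → ℕ) : Prop where
  source : ∀ t < k, p t ≠ 0 → out (p t - 1) = n + sink t + 2
  used : ∀ t < k, p t ≠ 0 → out (n + sink t) = 1
  unused : ∀ g, (∀ t < k, p t ≠ 0 → sink t ≠ g) → out (n + g) = 0

theorem outputProg_runs {v : ℕ → ℝ} (hN : s.nat slotsVar 0 = N) (h0 : s.nat 3 = 0)
    (hm : Matching N c (s.nat 0 0) (s.nat rowArr) v) :
    Runs outputProg s (N * 100 + 100) fun s' => Frame [colVar, 3] [] s s' ∧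
      Output (s.nat 0 0) N (s.nat rowArr) (s.nat sinkArr) (s'.nat 3) := by
  refine Runs.forN (N := N) (T := 70)
    (I := fun k s' => s'.nat colVar 0 = k ∧ Frame [colVar, 3] [] s s' ∧
      Output (s.nat 0 0) k (s.nat rowArr) (s.nat sinkArr) (s'.nat 3))
    ⟨by simp, (Frame.refl ..).setNat _ _ (by simp), ⟨by simp, by simp, by simp [h0]⟩⟩
    (fun k s' h => h.1)
    (fun k s' hI => ?_) (fun k s' hk hI => ?_) (fun s' hI => hI.2) ?_
  · simp [NExp.eval, hI.2.1.nat, hN]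
  · obtain ⟨hcol, hF, hI⟩ := hI
    refine Runs.ite (T := 50) (fun hb => ?_) (fun hb => ?_) (by decide) <;>
    simp only [BExp.Holds, NExp.eval, hcol, hF.nat rowArr (by simp), Nat.le_zero] at hb
    · refine Runs.skip (by simp) ⟨hcol, by simp, hF.setNat _ _ (by simp), ?_⟩
      rw [State.setNat_nat_of_ne _ _ _ (by simp)]
      refine ⟨fun t ht hp => ?_, fun t ht hp => ?_,
        fun g hg => hI.unused g fun t ht => hg t (Nat.lt_succ_of_lt ht)⟩ <;>
      rcases Nat.lt_succ_iff_lt_or_eq.1 ht with ht | rfl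
      · exact hI.source t ht hp
      · exact absurd hb hp
      · exact hI.used t ht hp
      · exact absurd hb hp
    · refine Runs.seq_setNat (T₂ := 20) ?_ (by decide)
      refine Runs.setNat (by decide) ⟨by simp [hcol], by simp,
        ((hF.setNat _ _ (by simp)).setNat _ _ (by simp)).setNat _ _ (by simp), ?_⟩
      have hk' := hm.le k hk
      simp only [NExp.eval, ne_eq, Nat.reduceEqDiff, not_false_eq_true, State.setNat_nat_of_ne,
        OfNat.zero_ne_ofNat, State.setNat_nat_self, hcol, hF.nat 0, hF.nat rowArr,
        hF.nat sinkArr, List.mem_cons, List.not_mem_nil, or_self]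
      refine ⟨fun t ht hp => ?_, fun t ht hp => ?_, fun g hg => ?_⟩
      · have ht' := hm.le t (by omega)
        rw [Function.update_of_ne (by omega)]
        rcases Nat.lt_succ_iff_lt_or_eq.1 ht with ht | rfl
        · rw [Function.update_of_ne, hI.source t ht hp]
          intro he
          exact ht.ne (hm.inj t (by omega) k hk (by omega) hp)
        · rw [Function.update_self]
      · rw [Function.update_apply]
        split_ifs with he
        · rfl
        · rcases Nat.lt_succ_iff_lt_or_eq.1 ht with ht | rfl
          · rw [Function.update_of_ne (by omega), hI.used t ht hp]
          · exact absurd rfl he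
      · have := hg k (Nat.lt_succ_self k) hb
        rw [Function.update_of_ne (by omega), Function.update_of_ne (by omega),
          hI.unused g fun t ht => hg t (Nat.lt_succ_of_lt ht)]
  · simp only [NExp.time]
    omega

/-- What the program computes on a memory that is zero outside its input. -/
theorem solver_runs (hslots : s.nat slotsVar 0 = 0) (hrow : s.nat rowArr = 0)
    (hprice : s.real priceArr = 0) (hout : s.nat 3 = 0) (hflag : s.nat 2 = 0)
    (hcap : 1 ≤ s.nat 1 0) (hN : s.nat 1 0 * s.nat 0 1 = N) :
    Runs solver s ((N + 1) * (N + 1) * (N + 1) * 3000) fun s' =>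
      (N < s.nat 0 0 ∧ s'.nat 2 0 = 0) ∨
      (s'.nat 2 0 = 1 ∧ s'.nat 2 1 = 0 ∧ ∃ c p v sink, Matching N c (s.nat 0 0) p v ∧
        (∀ r, ∀ t < N, c r t =
          √((s.real 1 (r - 1) - s.real 3 (t % s.nat 0 1)) ^ 2
            + (s.real 2 (r - 1) - s.real 4 (t % s.nat 0 1)) ^ 2)) ∧
        (∀ t < N, sink t = t % s.nat 0 1) ∧
        Output (s.nat 0 0) N p sink (s'.nat 3)) := by
  have hkN : s.nat 0 1 ≤ N := by nlinarith
  refine Runs.seq (countProg_runs hslots) (fun s₁ ⟨hF₁, h₁⟩ => ?_)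
    (T₂ := (N + 1) * (N + 1) * (N + 1) * 2100 + (N * 200 + 300)) (by nlinarith)
  rw [hN] at h₁
  refine Runs.ite (T := (N + 1) * (N + 1) * (N + 1) * 2100 + (N * 200 + 250))
    (fun hb => ?_) (fun hb => ?_) (by simp only [BExp.time, NExp.time]; omega)
  · simp only [BExp.Holds, NExp.eval, h₁, hF₁.nat 0 (by simp)] at hb
    have hk : 0 < N → 0 < s₁.nat 0 1 := fun h => by
      rw [hF₁.nat 0 (by simp)]
      exact Nat.pos_of_mul_pos_left (hN ▸ h)
    refine Runs.seq (sinksProg_runs h₁ hk) (fun s₂ ⟨hF₂, h₂⟩ => ?_)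
      (T₂ := (N + 1) * (N + 1) * (N + 1) * 2100 + (N * 100 + 120)) (by omega)
    have hF := (hF₁.trans hF₂).mono (A' := [colVar, slotsVar, sinkArr]) (B' := []) (by simp)
      (by simp)
    have hd : Data N (fun r t => (costE (.const r) (.const t)).eval s₂) s₂ :=
      ⟨by rw [hF₂.nat _ (by simp), h₁], fun _ _ => rfl⟩
    have h0 : s₂.nat 0 0 = s.nat 0 0 := by rw [hF.nat _ (by simp)]
    have hm : Matching N (fun r t => (costE (.const r) (.const t)).eval s₂) 0 (s₂.nat rowArr)
        (s₂.real priceArr) := by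
      rw [hF.nat _ (by simp), hF.real _ (by simp), hrow, hprice]
      refine ⟨by simp, by simp, fun r h1 h2 => by omega, by simp, by simp, by simp⟩
    refine Runs.seq (matchProg_runs hd (by rwa [h0]) hm) (fun s₃ ⟨hF₃, h₃⟩ => ?_)
      (T₂ := N * 100 + 110) (by omega)
    rw [h0] at h₃
    have h0' : s₃.nat 0 0 = s.nat 0 0 := by rw [hF₃.nat _ (by simp), h0]
    refine Runs.seq (outputProg_runs (N := N) (c := fun r t => (costE (.const r) (.const t)).eval s₂)
      (v := s₃.real priceArr) ?_ ?_ (by rwa [h0']))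
      (fun s₄ ⟨hF₄, h₄⟩ => Runs.setNat (by decide) (Or.inr ?_)) (T₂ := 10) (by omega)
    · rw [hF₃.nat _ (by simp), hd.slots]
    · rw [hF₃.nat _ (by simp), hF.nat _ (by simp), hout]
    · rw [h0'] at h₄
      refine ⟨by simp [NExp.eval], ?_, _, _, _, s₃.nat sinkArr, h₃, fun r t ht => ?_,
        fun t ht => ?_, by simpa using h₄⟩
      · simp [NExp.eval, hF₄.nat, hF₃.nat, hF.nat, hflag]
      · simp [costE, sqDiffE, RExp.eval, NExp.eval, hF.real, h₂ t ht, hF₁.nat, sq]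
      · rw [hF₃.nat _ (by simp), h₂ t ht, hF₁.nat _ (by simp)]
  · simp only [BExp.Holds, NExp.eval, h₁, hF₁.nat 0 (by simp), not_le] at hb
    exact Runs.skip (by omega) (Or.inl ⟨hb, by simp [hF₁.nat, hflag]⟩)

end Hungarian

/-! ### Rooted forests -/

theorem ancestor_add {V : Type} (parent : V → Option V) (a b : ℕ) (v : V) :
    ancestor parent (a + b) v = (ancestor parent a v).bind (ancestor parent b) := by
  induction a generalizing v with
  | zero => simp [ancestor]
  | succ a ih =>
    rw [Nat.succ_add]
    simp only [ancestor]
    cases parent v with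
    | none => rfl
    | some w => simp [ih]

theorem ancestor_eq_none {V : Type} {parent : V → Option V} {v : V} (h : parent v = none)
    (d : ℕ) : ancestor parent (d + 1) v = none := by
  simp [ancestor, h]

/-- All paths from a vertex to a root have the same length. -/
theorem ancestor_root_unique {V : Type} {parent : V → Option V} {v r r' : V} {a b : ℕ}
    (ha : ancestor parent a v = some r) (hr : parent r = none)
    (hb : ancestor parent b v = some r') (hr' : parent r' = none) : a = b := by
  rcases lt_trichotomy a b with h | h | h
  · obtain ⟨d, rfl⟩ := Nat.exists_eq_add_of_lt h
    rw [add_assoc, ancestor_add, ha, Option.bind_some, ancestor_eq_none hr] at hb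
    cases hb
  · exact h
  · obtain ⟨d, rfl⟩ := Nat.exists_eq_add_of_lt h
    rw [add_assoc, ancestor_add, hb, Option.bind_some, ancestor_eq_none hr'] at ha
    cases ha

namespace RootedForest

variable {V : Type}

theorem ancestor_mem (F : RootedForest V) {v w : V} (hv : v ∈ F.verts) {a : ℕ}
    (h : ancestor F.parent a v = some w) : w ∈ F.verts := by
  induction a generalizing v with
  | zero =>
    obtain rfl : v = w := by simpa [ancestor] using h
    exact hv
  | succ a ih =>
    simp only [ancestor, Option.bind_eq_some_iff] at h
    obtain ⟨u, hu, h⟩ := h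
    exact ih (F.parent_mem v u hu).2 h

theorem load_of_isLeaf (F : RootedForest V) {v : V} (hv : F.IsLeaf v) : F.load v = 1 := by
  have : {u | F.IsLeaf u ∧ ∃ i, ancestor F.parent i u = some v} = {v} := by
    ext u
    simp only [Set.mem_ofPred_eq, Set.mem_singleton_iff]
    constructor
    · rintro ⟨-, i, hi⟩
      induction i generalizing u with
      | zero => simpa [ancestor] using hi
      | succ i ih =>
        simp only [ancestor, Option.bind_eq_some_iff] at hi
        obtain ⟨w, hw, hi⟩ := hi
        rw [ih w hi] at hw
        exact absurd hw (hv.2 u)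
    · rintro rfl
      exact ⟨hv, 0, rfl⟩
  rw [load, this, Set.ncard_singleton]

/-- The length of the edge from `u` to its parent, or `0` for a root. -/
noncomputable def edgeLength (F : RootedForest V) (pos : V → EuclideanSpace ℝ (Fin 2)) (u : V) :
    ℝ :=
  match F.parent u with
  | some v => dist (pos u) (pos v)
  | none => 0

theorem edgeLength_nonneg (F : RootedForest V) (pos : V → EuclideanSpace ℝ (Fin 2)) (u : V) :
    0 ≤ F.edgeLength pos u := by
  unfold edgeLength
  split
  · exact dist_nonneg
  · exact le_rfl

theorem cost_eq (F : RootedForest V) (pos : V → EuclideanSpace ℝ (Fin 2)) (α : ℝ) :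
    F.cost pos α = ∑ u ∈ F.verts, F.edgeLength pos u * (F.load u : ℝ) ^ α := by
  refine Finset.sum_congr rfl fun u _ => ?_
  unfold edgeLength
  split <;> simp [*]

open Classical in
/-- The distance of a vertex to its root is at most the length of the path. -/
theorem dist_root_le (F : RootedForest V) (pos : V → EuclideanSpace ℝ (Fin 2)) {v r : V}
    (hv : v ∈ F.verts) {n : ℕ} (h : ancestor F.parent n v = some r) (hr : F.parent r = none) :
    dist (pos v) (pos r) ≤
      ∑ u ∈ F.verts with ∃ i, ancestor F.parent i v = some u, F.edgeLength pos u := by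
  induction n generalizing v with
  | zero =>
    obtain rfl : v = r := by simpa [ancestor] using h
    rw [dist_self]
    exact Finset.sum_nonneg fun u _ => F.edgeLength_nonneg pos u
  | succ n ih =>
    have h' := h
    simp only [ancestor, Option.bind_eq_some_iff] at h
    obtain ⟨w, hw, h⟩ := h
    have hmem := F.parent_mem v w hw
    -- the path from the parent `w` to the root does not return to `v`
    have hnot : v ∉ F.verts.filter fun u => ∃ i, ancestor F.parent i w = some u := by
      rw [Finset.mem_filter]
      rintro ⟨-, i, hi⟩
      have : ancestor F.parent (i + (n + 1)) w = some r := by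
        rw [ancestor_add, hi, Option.bind_some, h']
      have := ancestor_root_unique this hr h hr
      omega
    have hsub : insert v (F.verts.filter fun u => ∃ i, ancestor F.parent i w = some u) ⊆
        F.verts.filter fun u => ∃ i, ancestor F.parent i v = some u := by
      intro u hu
      rw [Finset.mem_insert, Finset.mem_filter] at hu
      rw [Finset.mem_filter]
      rcases hu with rfl | ⟨hu, i, hi⟩
      · exact ⟨hv, 0, rfl⟩
      · exact ⟨hu, i + 1, by simp [ancestor, hw, hi]⟩
    calc dist (pos v) (pos r) ≤ dist (pos v) (pos w) + dist (pos w) (pos r) :=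
          dist_triangle _ _ _
      _ ≤ F.edgeLength pos v + ∑ u ∈ F.verts with ∃ i, ancestor F.parent i w = some u,
            F.edgeLength pos u := by
          refine add_le_add (by simp [edgeLength, hw]) (ih hmem.2 h)
      _ = ∑ u ∈ insert v (F.verts.filter fun u => ∃ i, ancestor F.parent i w = some u),
            F.edgeLength pos u := (Finset.sum_insert hnot).symm
      _ ≤ _ := Finset.sum_le_sum_of_subset_of_nonneg hsub fun u _ _ => F.edgeLength_nonneg pos u

end RootedForest

namespace FLaMECaST

variable {I : Instance}

/-! ### Layouts and assignments -/

/-- An assignment of the sources to the sinks that respects the capacity of the roots. -/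
def RespectsCapacity (I : Instance) (τ : Fin I.numSources → Fin I.numSinks) : Prop :=
  ∀ j, (Finset.univ.filter fun i => τ i = j).card ≤ I.cap 0

namespace Layout

theorem isLeaf_source (L : Layout I) (i : Fin I.numSources) :
    L.forest.IsLeaf (Vertex.source i) :=
  (L.leaves _).2 ⟨i, rfl⟩

/-- In every layout, each source has a sink as its root. -/
theorem exists_root (L : Layout I) (i : Fin I.numSources) :
    ∃ (j : Fin I.numSinks) (n : ℕ),
      ancestor L.forest.parent n (Vertex.source i) = some (Vertex.sink j) ∧
      L.forest.parent (Vertex.sink j) = none ∧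
      (Vertex.sink j : Vertex I L.numSteiner) ∈ L.forest.verts := by
  have hmem := (L.isLeaf_source i).1
  obtain ⟨n, r, hr, hroot⟩ := L.forest.exists_root _ hmem
  have hrm := L.forest.ancestor_mem hmem hr
  obtain ⟨j, rfl⟩ := L.roots r ⟨hrm, hroot⟩
  exact ⟨j, n, hr, hroot, hrm⟩

/-- The sink that is the root of source `i`. -/
noncomputable def rootSink (L : Layout I) (i : Fin I.numSources) : Fin I.numSinks :=
  (L.exists_root i).choose

theorem rootSink_spec (L : Layout I) (i : Fin I.numSources) :
    ∃ n : ℕ, ancestor L.forest.parent n (Vertex.source i) = some (Vertex.sink (L.rootSink i)) ∧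
      L.forest.parent (Vertex.sink (L.rootSink i)) = none ∧
      (Vertex.sink (L.rootSink i) : Vertex I L.numSteiner) ∈ L.forest.verts :=
  (L.exists_root i).choose_spec

open Classical in
theorem load_eq_card (L : Layout I) (v : Vertex I L.numSteiner) :
    L.forest.load v = (Finset.univ.filter fun i : Fin I.numSources =>
      ∃ k, ancestor L.forest.parent k (Vertex.source i) = some v).card := by
  have : {u | L.forest.IsLeaf u ∧ ∃ k, ancestor L.forest.parent k u = some v} =
      Vertex.source '' ((Finset.univ.filter fun i : Fin I.numSources =>
        ∃ k, ancestor L.forest.parent k (Vertex.source i) = some v : Finset _) : Set _) := by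
    ext u
    simp only [L.leaves, Set.mem_ofPred_eq, Finset.coe_filter, Finset.mem_univ, true_and,
      Set.mem_image]
    constructor
    · rintro ⟨⟨i, rfl⟩, h⟩
      exact ⟨i, h, rfl⟩
    · rintro ⟨i, h, rfl⟩
      exact ⟨⟨i, rfl⟩, h⟩
  rw [RootedForest.load, this, Set.ncard_image_of_injective _ Sum.inl_injective,
    Set.ncard_coe_finset]

theorem respectsCapacity_rootSink (L : Layout I) (hL : L.Valid) :
    RespectsCapacity I L.rootSink := by
  classical
  intro j
  rcases (Finset.univ.filter fun i => L.rootSink i = j).eq_empty_or_nonempty with h | ⟨i, hi⟩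
  · simp [h]
  · obtain ⟨n, -, hroot, hmem⟩ := L.rootSink_spec i
    rw [(Finset.mem_filter.1 hi).2] at hroot hmem
    refine le_trans ?_ (hL _ hmem 0 ⟨_, rfl, hmem, hroot⟩)
    rw [L.load_eq_card]
    refine Finset.card_le_card fun i' hi' => ?_
    obtain ⟨n', h', -, -⟩ := L.rootSink_spec i'
    rw [(Finset.mem_filter.1 hi').2] at h'
    exact Finset.mem_filter.2 ⟨Finset.mem_univ _, n', h'⟩

/-- If `α = 1`, the cost is the total length of the paths from the sources to their roots; if
there are no intermediate layers, these paths are single edges. -/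
theorem sum_dist_le_cost (L : Layout I) (hI : I.alpha = 1 ∨ I.lam = 0) :
    ∑ i, dist (I.source i) (I.sink (L.rootSink i)) ≤ L.cost := by
  classical
  rw [Layout.cost, RootedForest.cost_eq]
  rcases hI with hI | hI
  · calc ∑ i, dist (I.source i) (I.sink (L.rootSink i))
        ≤ ∑ i : Fin I.numSources, ∑ u ∈ L.forest.verts with
            ∃ k, ancestor L.forest.parent k (Vertex.source i) = some u,
            L.forest.edgeLength L.pos u := by
          refine Finset.sum_le_sum fun i _ => ?_
          obtain ⟨n, h, hroot, -⟩ := L.rootSink_spec i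
          rw [← L.pos_source, ← L.pos_sink]
          exact L.forest.dist_root_le L.pos (L.isLeaf_source i).1 h hroot
      _ = ∑ u ∈ L.forest.verts, L.forest.edgeLength L.pos u * (L.forest.load u : ℝ)
            ^ I.alpha := by
          simp only [Finset.sum_filter]
          rw [Finset.sum_comm]
          refine Finset.sum_congr rfl fun u _ => ?_
          rw [hI, Real.rpow_one, L.load_eq_card, ← Finset.sum_filter, Finset.sum_const,
            nsmul_eq_mul, mul_comm]
  · have hsub : Finset.univ.image (fun i => (Vertex.source i : Vertex I L.numSteiner)) ⊆
        L.forest.verts := by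
      intro v hv
      obtain ⟨i, -, rfl⟩ := Finset.mem_image.1 hv
      exact (L.isLeaf_source i).1
    refine le_trans (le_of_eq ?_) (Finset.sum_le_sum_of_subset_of_nonneg hsub fun u _ _ =>
      mul_nonneg (L.forest.edgeLength_nonneg L.pos u) (Real.rpow_nonneg (Nat.cast_nonneg _) _))
    rw [Finset.sum_image fun _ _ _ _ h => Sum.inl_injective h]
    refine Finset.sum_congr rfl fun i _ => ?_
    obtain ⟨n, h, hroot, hmem⟩ := L.rootSink_spec i
    have hn := L.height _ (L.isLeaf_source i).1 n ⟨_, h, hmem, hroot⟩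
    have hparent : L.forest.parent (Vertex.source i) = some (Vertex.sink (L.rootSink i)) := by
      obtain rfl | rfl : n = 0 ∨ n = 1 := by omega
      · simp [ancestor] at h
      · simpa [ancestor] using h
    rw [L.forest.load_of_isLeaf (L.isLeaf_source i)]
    simp only [RootedForest.edgeLength, hparent, L.pos_source, L.pos_sink, Nat.cast_one,
      Real.one_rpow, mul_one]

end Layout

/-- The parent pointers of the forest of stars in which every source is a child of its sink. -/
def starParent (τ : Fin I.numSources → Fin I.numSinks) : Vertex I 0 → Option (Vertex I 0)
  | Sum.inl i => some (Vertex.sink (τ i))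
  | Sum.inr _ => none

/-- The vertices of the forest of stars: all sources, and the sinks that have sources. -/
def InStar (τ : Fin I.numSources → Fin I.numSinks) : Vertex I 0 → Prop
  | Sum.inl _ => True
  | Sum.inr (Sum.inl j) => ∃ i, τ i = j
  | Sum.inr (Sum.inr _) => False

open Classical in
/-- The layout in which every source is joined to its sink by an edge. -/
noncomputable def starLayout (τ : Fin I.numSources → Fin I.numSinks) : Layout I where
  numSteiner := 0
  forest :=
    { verts := Finset.univ.filter (InStar τ)
      parent := starParent τ
      parent_mem := by
        rintro (i | v) w h
        · obtain rfl : Vertex.sink (τ i) = w := by simpa [starParent] using h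
          simp [InStar]
        · simp [starParent] at h
      exists_root := by
        rintro (i | v) -
        · exact ⟨1, Vertex.sink (τ i), rfl, rfl⟩
        · exact ⟨0, Sum.inr v, rfl, rfl⟩ }
  leaves := by
    rintro (i | j | l)
    · simp only [RootedForest.IsLeaf, Finset.mem_filter, Finset.mem_univ, true_and]
      refine ⟨fun _ => ⟨i, rfl⟩, fun _ => ⟨trivial, ?_⟩⟩
      rintro (i' | v) <;> simp [starParent]
    · simp only [RootedForest.IsLeaf, Finset.mem_filter, Finset.mem_univ, true_and]
      constructor
      · rintro ⟨⟨i, rfl⟩, h⟩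
        exact absurd rfl (h (Vertex.source i))
      · rintro ⟨i, hi⟩
        cases hi
    · exact l.elim0
  roots := by
    rintro (i | j | l) ⟨-, h⟩
    · simp [starParent] at h
    · exact ⟨j, rfl⟩
    · exact l.elim0
  height := by
    rintro v - i ⟨r, hi, -⟩
    by_contra! hlt
    obtain ⟨d, rfl⟩ : ∃ d, i = d + 2 := ⟨i - 2, by omega⟩
    rcases v with v | v <;> simp [ancestor, starParent] at hi
  pos := Sum.elim I.source (Sum.elim I.sink fun l => l.elim0)
  pos_source _ := rfl
  pos_sink _ := rfl

theorem starLayout_valid {τ : Fin I.numSources → Fin I.numSinks} (hτ : RespectsCapacity I τ) :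
    (starLayout τ).Valid := by
  classical
  rintro (i | j | l) hv m ⟨r, hr, hroot⟩
  · rw [RootedForest.load_of_isLeaf _ ((starLayout τ).isLeaf_source i)]
    exact I.one_le_cap m
  · have hm : m = 0 := by
      refine Fin.ext ?_
      by_contra hm
      obtain ⟨d, hd⟩ := Nat.exists_eq_succ_of_ne_zero hm
      rw [hd, ancestor_eq_none (by rfl)] at hr
      cases hr
    rw [hm, Layout.load_eq_card]
    refine le_trans (Finset.card_le_card fun i hi => ?_) (hτ j)
    obtain ⟨-, k, hk⟩ := Finset.mem_filter.1 hi
    refine Finset.mem_filter.2 ⟨Finset.mem_univ _, ?_⟩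
    rcases k with - | - | k
    · simp [ancestor] at hk
    · simpa [ancestor, starLayout, starParent] using hk
    · simp [ancestor, starLayout, starParent] at hk
  · exact l.elim0

theorem starLayout_cost (τ : Fin I.numSources → Fin I.numSinks) :
    (starLayout τ).cost = ∑ i, dist (I.source i) (I.sink (τ i)) := by
  classical
  have hlen : ∀ v, (starLayout τ).forest.edgeLength (starLayout τ).pos v =
      Sum.elim (fun i => dist (I.source i) (I.sink (τ i))) (fun _ => 0) v := by
    rintro (i | v) <;> rfl
  have hsub : Finset.univ.image (fun i => (Vertex.source i : Vertex I 0)) ⊆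
      (starLayout τ).forest.verts := by
    intro v hv
    obtain ⟨i, -, rfl⟩ := Finset.mem_image.1 hv
    exact ((starLayout τ).isLeaf_source i).1
  rw [Layout.cost, RootedForest.cost_eq]
  refine (Finset.sum_subset hsub fun v _ hv => ?_).symm.trans ?_
  · rcases v with i | v
    · exact absurd (Finset.mem_image.2 ⟨i, Finset.mem_univ _, rfl⟩) hv
    · exact (congrArg (· * _) (hlen (Sum.inr v))).trans (zero_mul _)
  · rw [Finset.sum_image fun _ _ _ _ h => Sum.inl_injective h]
    refine Finset.sum_congr rfl fun i _ => ?_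
    refine (congrArg₂ (fun (x : ℝ) (n : ℕ) => x * (n : ℝ) ^ I.alpha) (hlen (Sum.inl i))
      (RootedForest.load_of_isLeaf _ ((starLayout τ).isLeaf_source i))).trans ?_
    simp

theorem starLayout_optimal (hI : I.alpha = 1 ∨ I.lam = 0)
    {τ : Fin I.numSources → Fin I.numSinks} (hτ : RespectsCapacity I τ)
    (hmin : ∀ τ', RespectsCapacity I τ' →
      ∑ i, dist (I.source i) (I.sink (τ i)) ≤ ∑ i, dist (I.source i) (I.sink (τ' i))) :
    (starLayout τ).Optimal := by
  refine ⟨starLayout_valid hτ, fun L hL => ?_⟩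
  rw [starLayout_cost]
  exact (hmin _ (L.respectsCapacity_rootSink hL)).trans (L.sum_dist_le_cost hI)

/-! ### Assignments and slots -/

/-- The sink of a slot. -/
def slotSink (I : Instance) (t : Fin (I.cap 0 * I.numSinks)) : Fin I.numSinks := t.modNat

/-- The sources of each sink can be given different slots of that sink. -/
theorem RespectsCapacity.exists_slots {τ : Fin I.numSources → Fin I.numSinks}
    (hτ : RespectsCapacity I τ) :
    ∃ q : Fin I.numSources → Fin (I.cap 0 * I.numSinks), Function.Injective q ∧
      ∀ i, slotSink I (q i) = τ i := by
  have h : ∀ j, Nonempty ({i // τ i = j} ↪ Fin (I.cap 0)) := fun j => by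
    rw [Function.Embedding.nonempty_iff_card_le, Fintype.card_fin, Fintype.card_subtype]
    exact hτ j
  let e := fun j => (h j).some
  refine ⟨fun i => finProdFinEquiv (e (τ i) ⟨i, rfl⟩, τ i), fun i i' hii => ?_, fun i => ?_⟩
  · have h1 := finProdFinEquiv.injective hii
    rw [Prod.mk.injEq] at h1
    obtain ⟨h1, h2⟩ := h1
    have : ∀ j (hj : τ i' = j), e (τ i') ⟨i', rfl⟩ = e j ⟨i', hj⟩ := by
      rintro _ rfl
      rfl
    rw [this _ h2.symm] at h1
    simpa using (e (τ i)).injective h1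
  · exact congrArg Prod.snd (finProdFinEquiv.symm_apply_apply (e (τ i) ⟨i, rfl⟩, τ i))

theorem RespectsCapacity.of_slots {q : Fin I.numSources → Fin (I.cap 0 * I.numSinks)}
    (hq : Function.Injective q) : RespectsCapacity I fun i => slotSink I (q i) := by
  intro j
  refine (Finset.card_le_card_of_injOn (t := (Finset.univ : Finset (Fin (I.cap 0))))
    (fun i => (q i).divNat) (fun _ _ => Finset.mem_coe.2 (Finset.mem_univ _))
    fun i hi i' hi' h => ?_).trans (by simp)
  have h1 : slotSink I (q i) = j := by simpa using hi
  have h2 : slotSink I (q i') = j := by simpa using hi'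
  exact hq (finProdFinEquiv.symm.injective (Prod.ext h (h1.trans h2.symm)))

theorem numSources_le_of_feasible (h : Feasible I) : I.numSources ≤ I.cap 0 * I.numSinks := by
  obtain ⟨L, hL⟩ := h
  obtain ⟨q, hq, -⟩ := (L.respectsCapacity_rootSink hL).exists_slots
  simpa using Fintype.card_le_of_injective q hq

end FLaMECaST

namespace FLaMECaST

variable {I : Instance}

/-! ### Correctness and running time -/

theorem slotSink_val (t : Fin (I.cap 0 * I.numSinks)) :
    (slotSink I t : ℕ) = t % I.numSinks := rfl

theorem starLayout_encodedBy {τ : Fin I.numSources → Fin I.numSinks} {s : RealRAM.State}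
    (h : s.nat 2 1 = 0) (hsource : ∀ i : Fin I.numSources, s.nat 3 i = I.numSources + τ i + 2)
    (hused : ∀ i, s.nat 3 (I.numSources + τ i) = 1)
    (hunused : ∀ j : Fin I.numSinks, (∀ i, τ i ≠ j) → s.nat 3 (I.numSources + j) = 0) :
    (starLayout τ).EncodedBy s := by
  classical
  have hmem : ∀ v : Vertex I 0, v ∈ (starLayout τ).forest.verts ↔ InStar τ v := fun v =>
    Finset.mem_filter.trans (and_iff_right (Finset.mem_univ v))
  refine ⟨h, ?_, fun l => l.elim0⟩
  rintro (i | j | l)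
  · exact (hsource i).trans (if_pos ((hmem (Sum.inl i)).2 trivial)).symm
  · by_cases hj : ∃ i, τ i = j
    · refine Eq.trans ?_ (if_pos ((hmem (Sum.inr (Sum.inl j))).2 hj)).symm
      obtain ⟨i, rfl⟩ := hj
      exact hused i
    · refine Eq.trans ?_ (if_neg fun hm => hj ((hmem (Sum.inr (Sum.inl j))).1 hm)).symm
      exact hunused j fun i hi => hj ⟨i, hi⟩
  · exact l.elim0

theorem input_dist (i : Fin I.numSources) (j : Fin I.numSinks) :
    √((I.input.real 1 i - I.input.real 3 j) ^ 2 + (I.input.real 2 i - I.input.real 4 j) ^ 2) =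
      dist (I.source i) (I.sink j) := by
  simp [Instance.input, EuclideanSpace.dist_eq, Real.dist_eq]

theorem time_bound (N : ℕ) : (N + 1) * (N + 1) * (N + 1) * 3000 ≤ 12000 * (N ^ 3 + 1) := by
  rcases N with - | M
  · norm_num
  · nlinarith [Nat.zero_le (M * M * (M + 2))]

theorem solver_solvesInTime :
    SolvesInTime Hungarian.solver {I : Instance | I.alpha = 1 ∨ I.lam = 0}
      (fun I => (I.cap 0 * I.numSinks) ^ 3) := by
  refine ⟨12000, fun I hI => ?_⟩
  have h00 : I.input.nat 0 0 = I.numSources := by simp [Instance.input]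
  have h01 : I.input.nat 0 1 = I.numSinks := by simp [Instance.input]
  have h10 : I.input.nat 1 0 = I.cap 0 := by simp [Instance.input]
  obtain ⟨s, t, he, ht, hs⟩ := Hungarian.solver_runs (s := I.input)
    (N := I.cap 0 * I.numSinks) (by simp [Instance.input]) (by ext; simp [Instance.input])
    (by ext; simp [Instance.input]) (by ext; simp [Instance.input])
    (by ext; simp [Instance.input]) (by rw [h10]; exact I.one_le_cap 0) (by rw [h10, h01])
  refine ⟨s, t, he, ?_, ht.trans ?_⟩
  · rw [h00, h01] at hs
    rcases hs with ⟨hlt, h20⟩ | ⟨h20, h21, c, p, v, sink, hm, hc, hsink, hout⟩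
    · exact Or.inl ⟨h20, fun hf => absurd (numSources_le_of_feasible hf) hlt.not_ge⟩
    · refine Or.inr ⟨h20, ?_⟩
      have hex : ∀ i : Fin I.numSources, ∃ t : Fin (I.cap 0 * I.numSinks), p t = i + 1 :=
        fun i => by
          obtain ⟨t, ht, hp⟩ := hm.surj (i + 1) (by omega) (by omega)
          exact ⟨⟨t, ht⟩, hp⟩
      choose m hpm using hex
      have hcost : ∀ (i : Fin I.numSources) (t : Fin (I.cap 0 * I.numSinks)),
          c (i + 1) t = dist (I.source i) (I.sink (slotSink I t)) := fun i t => by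
        rw [hc _ _ t.2, ← input_dist, Nat.add_sub_cancel, slotSink_val]
      have hinj : Function.Injective m := fun i i' hii => by
        have := hpm i
        rw [hii, hpm i'] at this
        exact Fin.ext (by omega)
      refine ⟨starLayout fun i => slotSink I (m i), starLayout_optimal hI
        (.of_slots hinj) fun τ' hτ' => ?_, starLayout_encodedBy h21
        (fun i => ?_) (fun i => ?_) fun j hj => hout.unused j fun t ht hp hj' => ?_⟩
      · obtain ⟨q, hq, hqτ⟩ := hτ'.exists_slots
        simpa only [hcost, hqτ] using hm.sum_le hpm hq
      · have := hout.source (m i) (m i).2 (by rw [hpm]; omega)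
        rwa [hpm, Nat.add_sub_cancel, hsink _ (m i).2] at this
      · have := hout.used (m i) (m i).2 (by rw [hpm]; omega)
        rwa [hsink _ (m i).2] at this
      · have hle := hm.le t ht
        have hmt := hpm ⟨p t - 1, by omega⟩
        have := hm.inj _ (m ⟨p t - 1, by omega⟩).2 t ht (by rw [hmt]; simp only; omega)
          (by rw [hmt]; omega)
        refine hj ⟨p t - 1, by omega⟩ (Fin.ext ?_)
        rw [slotSink_val, this, ← hj', hsink t ht]
  · exact time_bound _

end FLaMECaST

/-- One real RAM program solves FLaMECaST on all instances with `α = 1` or without intermediate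
layers, in `O((c₀ |T|)³)` steps. -/
theorem mainTheorem6 :
    ∃ p : RealRAM.Prog,
      FLaMECaST.SolvesInTime p
        {I : FLaMECaST.Instance | I.alpha = 1 ∨ I.lam = 0}
        (fun I => (I.cap 0 * I.numSinks) ^ 3) :=
  ⟨Hungarian.solver, FLaMECaST.solver_solvesInTime⟩
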